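/- Let $A$ be a finite alphabet and $k\ge 1$. **Marble bimachines.** A $k$-marble bimachine $\mathcal M$ over $A$ consists of a finite monoid $M$, a morphism $\mu:A^*\to M$ and an output function $\lambda$ on $M\times A\times M$, whose values are natural numbers if $k=1$ and $(k-1)$-marble bimachines over $A$ if $k\ge 2$. For a word $w$ and positions $i_1\le\dots\le i_k$ of $w$ put $h=\lambda(\mu(w[1{:}i_k{-}1]),w[i_k],\mu(w[i_k{+}1{:}|w|]))$; the production $\mathsf{prod}^w_{\mathcal M}\{\!\{i_1,\dots,i_k\}\!\}$ is $h$ if $k=1$, and the production of the machine $h$ on $w[1{:}i_k]$ and $\{\!\{i_1,\dots,i_{k-1}\}\!\}$ if $k\ge2$. For a multiset of sets of positions, $\mathsf{prod}^w_{\mathcal M}\{\!\{I_1,\dots,I_k\}\!\}$ is the sum of the productions over all multisets $\{\!\{i_1,\dots,i_k\}\!\}$ with $i_j\in I_j$ for all $j$. **Factorization forests.** Let $\hat A=A\uplus\{\langle,\rangle\}$. A $\mu$-factorization of a nonempty word $w$ is a word over $\hat A$ that is either $a$, if $w=a\in A$, or $\langle\mathcal F_1\rangle\cdots\langle\mathcal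 F_n\rangle$ with $n\ge1$, where $w=w_1\cdots w_n$, each $\mathcal F_i$ is a $\mu$-factorization of the nonempty word $w_i$, and, if $n\ge3$, all $\mu(w_i)$ are equal to one idempotent; the empty word is factored by the empty forest. A forest is viewed as a tree (letters are leaves, of height $0$). A node is iterable if it is neither the root nor the first or last child of its parent. The skeleton of a node consists of the node and of the skeletons of its first and last child; the frontier of a node is the set of positions of $w$ of the leaves of its skeleton. A multiset of nodes is independent if it is a set of iterable nodes such that no node of it is an ancestor of another one, or an immediate left or right sibling of another one or of an ancestor of another one. $\mathsf{Dep}^k(\mathcal F)$ is the set of multisets of $k$ nodes, each iterable or the root, that are not independent. For such a multiset, $\mathsf{prod}^{\mathcal F}_{\mathcal M}(\mathfrak T)$ is the production $\mathsf{prod}^w_{\mathcal M}$ on the multiset of the frontiers of its nodes. **Pebble transducers.** A $1$-pebble transducer over an alphabet $B$ is a bimachine: a finite monoid $M'$, a morphism $\mu':B^*\to M'$ and $\lambda':M'\times B\times M'\to\mathbb N$; it computes $w\mapsto\sum_{i}\lambda'(\mu'(w[1{:}i{-}1]),w[i],\mu'(w[i{+}1{:}|w|]))$. For $k\ge2$,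 a $k$-pebble transducer is a bimachine whose output function $\lambda'$ takes as values functions $h$ computed by $(k-1)$-pebble transducers over two copies of $B$ (plain and marked letters); it computes the sum over all positions $i$ of $h_i(w\text{ with position }i\text{ marked})$, where $h_i=\lambda'(\mu'(w[1{:}i{-}1]),w[i],\mu'(w[i{+}1{:}|w|]))$. A function $B^*\to\mathbb N$ is polyregular if it is computed by an $r$-pebble transducer for some $r\ge1$. **Statement.** Let $\mathcal M=(A,M,\mu,\lambda)$ be a $k$-marble bimachine and $K\in\mathbb N$ (for instance $K=3|M|$). Let $\mathsf{sumd}_{\mathcal M}:\hat A^*\to\mathbb N$ map $\mathcal F$ to $\sum_{\mathfrak T\in\mathsf{Dep}^k(\mathcal F)}\mathsf{prod}^{\mathcal F}_{\mathcal M}(\mathfrak T)$ if $\mathcal F$ is a $\mu$-factorization, of height at most $K$, of some $w\in A^*$, and to $0$ otherwise. Then $\mathsf{sumd}_{\mathcal M}$ is polyregular, and more precisely is computed by a $k$-pebble transducer, and there is a constant $C$ such that $\mathsf{sumd}_{\mathcal M}(\mathcal F)\le C\,|\mathcal F|^{k-1}$ for all $\mathcal F\in\hat A^*$ (with $0^0=1$).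 -/

import Mathlib

universe u v

/-! ## Polyregular functions with unary output: nested bimachines with pebbles -/

/-- The word `w` over `A` in which the position `i` carries a mark (marked letters are `inr`,
unmarked letters are `inl`). -/
def markAt {A : Type u} (w : List A) (i : Fin w.length) : List (A ⊕ A) :=
  (w.take i).map Sum.inl ++ Sum.inr w[i] :: (w.drop (i + 1)).map Sum.inl

/-- `PebbleComputable k f`: the function `f : A* → ℕ` is computed by a `k`-pebble transducer
(`k ≥ 1`), in its presentation by nested bimachines.
A `1`-pebble transducer is a bimachine with an output function `M × A × M → ℕ`. A
`(k+1)`-pebble transducer is a bimachine that calls, in each position `i` of its input, an external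
function chosen by the triple (value in `M` of the strict prefix, letter, value in `M` of the strict
suffix), computed by a `k`-pebble transducer, on the input where the position `i` is marked; the
outputs are added up. The level `k = 0` only serves to start the induction: a constant. -/
def PebbleComputable : (k : ℕ) → {A : Type u} → (List A → ℕ) → Prop
  | 0, _, f => ∃ c : ℕ, ∀ w, f w = c
  | k + 1, A, f =>
    ∃ (M : Type) (_ : Monoid M) (_ : Finite M) (μ : FreeMonoid A →* M)
      (ext : M → A → M → List (A ⊕ A) → ℕ),
      (∀ m a m', PebbleComputable k (ext m a m')) ∧
      ∀ w : List A, f w = ∑ i : Fin w.length,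
        ext (μ (FreeMonoid.ofList (w.take i))) w[i] (μ (FreeMonoid.ofList (w.drop (i + 1))))
          (markAt w i)

/-- A function `A* → ℕ` is polyregular if it is computed by some `k`-pebble transducer. -/
def Polyregular {A : Type u} (f : List A → ℕ) : Prop :=
  ∃ k, 1 ≤ k ∧ PebbleComputable k f

/-! ## Marble bimachines and their productions -/

/-- A `k`-marble bimachine over `A`, for `k ≥ 1`: a finite monoid `M`, a morphism `μ : A* → M`, and
an output function that maps each triple in `M × A × M` to an external function, presented by the
`(k-1)`-marble bimachine that computes it. For `k = 1` the output function has values in `ℕ`: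
`const c` stands for the number `c`. -/
inductive MarbleBimachine (A : Type u) : ℕ → Type (max u (v + 1))
  | const (c : ℕ) : MarbleBimachine A 0
  | node {k : ℕ} (M : Type v) [Monoid M] [Finite M] (μ : FreeMonoid A →* M)
      (out : M → A → M → MarbleBimachine A k) : MarbleBimachine A (k + 1)

namespace MarbleBimachine

variable {A : Type u}

/-- The function computed by a marble bimachine: in each position `i` the chosen external function
is called on the prefix that ends in `i`, and the results are added up. -/
def eval : {k : ℕ} → MarbleBimachine.{u, v} A k → List A → ℕ
  | _, const c, _ => c
  | _, node _ μ out, w => ∑ i : Fin w.length,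
      (out (μ (FreeMonoid.ofList (w.take i))) w[i] (μ (FreeMonoid.ofList (w.drop (i + 1))))).eval
        (w.take (i + 1))

/-- The production on positions given as a weakly decreasing list `i_k ≥ ⋯ ≥ i_1` of `k` positions
(counted from `0`): the submachine called in the largest position `i_k` is run on the prefix that
ends there. -/
def prodList : {k : ℕ} → MarbleBimachine.{u, v} A k → List A → List ℕ → ℕ
  | _, const c, _, [] => c
  | _, node _ μ out, w, i :: l =>
      match w[i]? with
      | some a =>
        (out (μ (FreeMonoid.ofList (w.take i))) a (μ (FreeMonoid.ofList (w.drop (i + 1))))).prodList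
          (w.take (i + 1)) l
      | none => 0
  | _, _, _, _ => 0

/-- The production on a multiset of `k` positions of `w`. -/
def prod {k : ℕ} (N : MarbleBimachine.{u, v} A k) (w : List A) (s : Multiset ℕ) : ℕ :=
  N.prodList w (s.sort (· ≥ ·))

open Classical in
/-- The production on a multiset `{{I_1, …, I_k}}` of sets of positions of `w`: the sum of the
productions on the multisets `{{i_1, …, i_k}}` of positions with `i_1 ∈ I_1, …, i_k ∈ I_k`. -/
noncomputable def prodSets {k : ℕ} (N : MarbleBimachine.{u, v} A k) (w : List A)
    (S : Multiset (Finset ℕ)) : ℕ :=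
  ∑ s ∈ ((Finset.range w.length).sym k).filter
      (fun s => Multiset.Rel (fun i I => i ∈ I) (s : Multiset ℕ) S),
    N.prod w s

end MarbleBimachine

/-! ## Factorization forests -/

/-- Ordered trees with leaves labelled in `A`. The empty forest is `node []`. -/
inductive FactForest (A : Type u) : Type u
  | leaf (a : A) : FactForest A
  | node (children : List (FactForest A)) : FactForest A

/-- The alphabet `A` with two additional brackets. -/
inductive Bracketed (A : Type u) : Type u
  | letter (a : A) : Bracketed A
  | op : Bracketed A
  | cl : Bracketed A

namespace FactForest

variable {A : Type u}

mutual
/-- The word factored by a forest. -/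
def yield : FactForest A → List A
  | leaf a => [a]
  | node cs => yieldList cs
/-- The concatenation of the words factored by the members of a list. -/
def yieldList : List (FactForest A) → List A
  | [] => []
  | c :: cs => yield c ++ yieldList cs
end

mutual
/-- A forest as a word: a leaf is its letter, a node is `⟨F_1⟩⋯⟨F_n⟩`. -/
def encode : FactForest A → List (Bracketed A)
  | leaf a => [Bracketed.letter a]
  | node cs => encodeList cs
/-- The word `⟨F_1⟩⋯⟨F_n⟩`. -/
def encodeList : List (FactForest A) → List (Bracketed A)
  | [] => []
  | c :: cs => Bracketed.op :: (encode c ++ Bracketed.cl :: encodeList cs)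
end

mutual
/-- The height; leaves have height `0`. -/
def height : FactForest A → ℕ
  | leaf _ => 0
  | node cs => heightList cs
/-- One plus the largest height in a nonempty list. -/
def heightList : List (FactForest A) → ℕ
  | [] => 0
  | c :: cs => max (height c + 1) (heightList cs)
end

/-- `F` is a `μ`-factorization of the nonempty word `F.yield`: a node has at least one child, and if
it has at least three, then all its children have as value one and the same idempotent. -/
inductive IsProper {M : Type v} [Monoid M] (μ : FreeMonoid A →* M) : FactForest A → Prop
  | leaf (a : A) : IsProper μ (leaf a)
  | node (cs : List (FactForest A)) (hne : cs ≠ []) (hcs : ∀ c ∈ cs, IsProper μ c)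
      (hidem : 3 ≤ cs.length →
        ∃ e : M, IsIdempotentElem e ∧ ∀ c ∈ cs, μ (FreeMonoid.ofList c.yield) = e) :
      IsProper μ (node cs)

/-- `F` is a `μ`-factorization of the word `F.yield`; the empty word is factored by the empty
forest. -/
def IsFactorization {M : Type v} [Monoid M] (μ : FreeMonoid A →* M) (F : FactForest A) : Prop :=
  F = node [] ∨ IsProper μ F

/-! Nodes are addressed by paths: `[]` is the root, `i :: p` is the node `p` of the child number `i`
(counted from `0`). -/

/-- The subtree at a path. -/
def subtree : FactForest A → List ℕ → Option (FactForest A)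
  | F, [] => some F
  | leaf _, _ :: _ => none
  | node cs, i :: p =>
    match cs[i]? with
    | some c => subtree c p
    | none => none

/-- The number of positions of the factored word that lie to the left of the subtree at a path. -/
def offset : FactForest A → List ℕ → ℕ
  | _, [] => 0
  | leaf _, _ :: _ => 0
  | node cs, i :: p =>
    match cs[i]? with
    | some c => (yieldList (cs.take i)).length + offset c p
    | none => 0

mutual
/-- The iterable nodes: those that are neither the first nor the last child of their parent; the
root is not iterable. -/
def iter : FactForest A → Finset (List ℕ)
  | leaf _ => ∅
  | node cs => (Finset.Ioo 0 (cs.length - 1)).image (fun i => [i]) ∪ iterFrom 0 cs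
/-- The iterable nodes that lie inside the members of a list of siblings, numbered from `j`. -/
def iterFrom (j : ℕ) : List (FactForest A) → Finset (List ℕ)
  | [] => ∅
  | c :: cs => (iter c).image (fun p => j :: p) ∪ iterFrom (j + 1) cs
end

mutual
/-- The positions of the leaves of the skeleton of a tree whose leftmost leaf is in position `o`.
The skeleton of a tree consists of its root and the skeletons of its first and of its last child. -/
def skeletonLeaves (o : ℕ) : FactForest A → Finset ℕ
  | leaf _ => {o}
  | node [] => ∅
  | node (c :: cs) => skeletonLeaves o c ∪ skeletonLeavesLast (o + (yield c).length) cs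
/-- The same for the last member of a list of consecutive siblings. -/
def skeletonLeavesLast (o : ℕ) : List (FactForest A) → Finset ℕ
  | [] => ∅
  | [c] => skeletonLeaves o c
  | c :: d :: cs => skeletonLeavesLast (o + (yield c).length) (d :: cs)
end

/-- The frontier of the node `t` of `F`: the positions of the word factored by `F` that are leaves of
the skeleton of `t`. -/
def frontier (F : FactForest A) (t : List ℕ) : Finset ℕ :=
  match F.subtree t with
  | some G => skeletonLeaves (F.offset t) G
  | none => ∅

/-- `s` is an ancestor of `t` (possibly `t` itself), or the immediate left or right sibling of an
ancestor of `t` (possibly of `t` itself). -/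
def AncestorOrSibling (s t : List ℕ) : Prop :=
  s <+: t ∨ ∃ (q : List ℕ) (i : ℕ),
    (s = q ++ [i] ∧ q ++ [i + 1] <+: t) ∨ (s = q ++ [i + 1] ∧ q ++ [i] <+: t)

/-- Independent multisets of nodes: they are sets of iterable nodes, none of which is an ancestor, or
an immediate sibling of an ancestor, of another one. -/
def Independent (F : FactForest A) (T : Multiset (List ℕ)) : Prop :=
  (∀ t ∈ T, t ∈ F.iter) ∧ T.Nodup ∧ ∀ s ∈ T, ∀ t ∈ T, s ≠ t → ¬ AncestorOrSibling s t

open Classical in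
/-- The dependent multisets: the multisets of `k` nodes, each iterable or the root, that are not
independent. -/
noncomputable def deps (F : FactForest A) (k : ℕ) : Finset (Sym (List ℕ) k) :=
  ((insert [] F.iter).sym k).filter (fun T => ¬ F.Independent (T : Multiset (List ℕ)))

mutual
theorem encode_append_cancel : ∀ (F G : FactForest A) (r r' : List (Bracketed A)),
    (∀ x ∈ r.head?, x = Bracketed.cl) → (∀ x ∈ r'.head?, x = Bracketed.cl) →
    encode F ++ r = encode G ++ r' → F = G ∧ r = r'
  | leaf a, leaf b, r, r', _, _, h => by
      simp only [encode, List.singleton_append, List.cons.injEq, Bracketed.letter.injEq] at h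
      exact ⟨by rw [h.1], h.2⟩
  | leaf a, node [], r, r', _, hr', h => by
      simp only [encode, encodeList, List.singleton_append, List.nil_append] at h
      have := hr' (Bracketed.letter a) (by simp [← h])
      cases this
  | leaf a, node (d :: ds), r, r', _, _, h => by
      simp [encode, encodeList] at h
  | node [], leaf b, r, r', hr, _, h => by
      simp only [encode, encodeList, List.singleton_append, List.nil_append] at h
      have := hr (Bracketed.letter b) (by simp [h])
      cases this
  | node (c :: cs), leaf b, r, r', _, _, h => by
      simp [encode, encodeList] at h
  | node cs, node ds, r, r', hr, hr', h => by
      simp only [encode] at h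
      obtain ⟨h1, h2⟩ := encodeList_append_cancel cs ds r r' hr hr' h
      exact ⟨by rw [h1], h2⟩
theorem encodeList_append_cancel : ∀ (cs ds : List (FactForest A)) (r r' : List (Bracketed A)),
    (∀ x ∈ r.head?, x = Bracketed.cl) → (∀ x ∈ r'.head?, x = Bracketed.cl) →
    encodeList cs ++ r = encodeList ds ++ r' → cs = ds ∧ r = r'
  | [], [], r, r', _, _, h => by simpa [encodeList] using h
  | [], d :: ds, r, r', hr, _, h => by
      simp only [encodeList, List.nil_append, List.cons_append] at h
      have := hr Bracketed.op (by simp [h])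
      cases this
  | c :: cs, [], r, r', _, hr', h => by
      simp only [encodeList, List.nil_append, List.cons_append] at h
      have := hr' Bracketed.op (by simp [← h])
      cases this
  | c :: cs, d :: ds, r, r', hr, hr', h => by
      simp only [encodeList, List.cons_append, List.append_assoc, List.cons.injEq, true_and] at h
      obtain ⟨h1, h2⟩ := encode_append_cancel c d _ _ (by simp) (by simp) h
      simp only [List.cons.injEq, true_and] at h2
      obtain ⟨h3, h4⟩ := encodeList_append_cancel cs ds r r' hr hr' h2
      exact ⟨by rw [h1, h3], h4⟩
end

/-- A word encodes at most one forest. -/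
theorem encode_injective : Function.Injective (encode : FactForest A → List (Bracketed A)) := by
  intro F G h
  exact (encode_append_cancel F G [] [] (by simp) (by simp) (by simpa using h)).1

end FactForest

/-! ## The sum of the productions over the dependent multisets -/

namespace MarbleBimachine

variable {A : Type u}

/-- The sum of the productions of `N` over the dependent multisets of `k` nodes of `F`. -/
noncomputable def depSum {k : ℕ} (N : MarbleBimachine.{u, v} A k) (F : FactForest A) : ℕ :=
  ∑ T ∈ F.deps k, N.prodSets F.yield ((T : Multiset (List ℕ)).map F.frontier)

/-- `F` is a factorization forest for the morphism of the (outermost) bimachine. -/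
def IsFactorization : {k : ℕ} → MarbleBimachine.{u, v} A k → FactForest A → Prop
  | _, const _, _ => False
  | _, node _ μ _, F => F.IsFactorization μ

open Classical in
/-- The function `sumd` on words over the bracketed alphabet, for forests of height at most `K`. -/
noncomputable def sumd {k : ℕ} (N : MarbleBimachine.{u, v} A k) (K : ℕ)
    (x : List (Bracketed A)) : ℕ :=
  if h : ∃ F : FactForest A, N.IsFactorization F ∧ F.height ≤ K ∧ F.encode = x then
    N.depSum h.choose
  else 0

theorem sumd_encode {k : ℕ} (N : MarbleBimachine.{u, v} A k) (K : ℕ) (F : FactForest A)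
    (hF : N.IsFactorization F) (hK : F.height ≤ K) : N.sumd K F.encode = N.depSum F := by
  have h : ∃ G : FactForest A, N.IsFactorization G ∧ G.height ≤ K ∧ G.encode = F.encode :=
    ⟨F, hF, hK, rfl⟩
  rw [sumd, dif_pos h, FactForest.encode_injective h.choose_spec.2.2]

end MarbleBimachine

-- The frontiers of the iterable nodes and of the root partition the positions of the word
-- (`mem_frontier_iff`), so each position has one owner among these nodes. A multiset of positions
-- therefore contributes to exactly one multiset of nodes, that of its owners. Since `prodList`
-- vanishes on lists that are not weakly decreasing, `depSum` becomes a sum over all `k`-tuples of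
-- positions whose owners are dependent (`depSum_eq_sum_tuples`).
--
-- Computability. A sum over `k`-tuples of a regular function of the word tagged by the tuple is
-- computed by `k` pebbles (`pebbleComputable_sum_tuples`): the first `k - 1` pebbles are dropped
-- blindly, and the last bimachine evaluates the function. The summand is regular for two reasons.
-- The production reads the word up to each called position (`exists_isRegularFun_prodList`).
-- Dependence means that one owner is the root or that two owners are linked; this is evaluated
-- bottom-up with finitely many values, reading each list of children by a finite automaton. As the
-- height is bounded, a parser with a bounded stack of such values is itself a finite automaton
-- (`isRegularFun_of_fold`). The same device checks that the forest is a factorization.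
--
-- Growth. Productions are bounded. A node has at most `3 * (K + 1)` ancestors and siblings of
-- ancestors, each with at most `2 ^ K` positions in its frontier. Hence a root-owned position, or
-- one of two linked positions once the other is chosen, has boundedly many choices, which leaves
-- `O(n ^ (k - 1))` dependent tuples (`card_filter_dependent_le`).

/-! ## Regular functions -/

/-- A function on words is regular if it has finitely many residuals. -/
def IsRegularFun {B X : Type*} (g : List B → X) : Prop :=
  (Set.range fun u y => g (u ++ y)).Finite

namespace IsRegularFun

variable {B C X Y : Type*} {g : List B → X}

/-- The residual factors through `st`, so the residuals are the image of a finite set. -/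
theorem of_residual {σ : Type*} (st : List B → σ) (hfin : (Set.range st).Finite)
    (hst : ∀ u u', st u = st u' → ∀ y, g (u ++ y) = g (u' ++ y)) : IsRegularFun g := by
  have hfac : Function.FactorsThrough (fun (u : List B) (y : List B) => g (u ++ y)) st := by
    intro u u' h
    funext y
    exact hst u u' h y
  refine (hfin.image (Function.extend st (fun (u : List B) (y : List B) => g (u ++ y))
    (fun _ _ => g []))).subset ?_
  rintro _ ⟨u, rfl⟩
  exact ⟨st u, ⟨u, rfl⟩, hfac.extend_apply _ u⟩

/-- A function determined by the state of a deterministic automaton with finitely many states is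
regular. -/
theorem of_state {σ : Type*} (st : List B → σ) (hfin : (Set.range st).Finite)
    (hst : ∀ u u' b, st u = st u' → st (u ++ [b]) = st (u' ++ [b]))
    (hg : ∀ u u', st u = st u' → g u = g u') : IsRegularFun g := by
  refine of_residual st hfin fun u u' h y => hg _ _ ?_
  induction y generalizing u u' with
  | nil => simpa using h
  | cons b y ih => simpa using ih (u ++ [b]) (u' ++ [b]) (hst u u' b h)

theorem finite_range (hg : IsRegularFun g) : (Set.range g).Finite := by
  refine (hg.image (fun ρ => ρ [])).subset ?_
  rintro _ ⟨u, rfl⟩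
  exact ⟨_, ⟨u, rfl⟩, by simp⟩

/-- In this and the next closure properties, a residual of the compound function is assembled from
residuals of its parts. -/
theorem comp (hg : IsRegularFun g) (f : X → Y) : IsRegularFun fun w => f (g w) := by
  refine (hg.image (fun ρ y => f (ρ y))).subset ?_
  rintro _ ⟨u, rfl⟩
  exact ⟨_, ⟨u, rfl⟩, rfl⟩

theorem prodMk (hg : IsRegularFun g) {g' : List B → Y} (hg' : IsRegularFun g') :
    IsRegularFun fun w => (g w, g' w) := by
  refine (Set.Finite.image2 (fun ρ ρ' y => (ρ y, ρ' y)) hg hg').subset ?_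
  rintro _ ⟨u, rfl⟩
  exact ⟨_, ⟨u, rfl⟩, _, ⟨u, rfl⟩, rfl⟩

theorem pi {ι : Type*} [Finite ι] {X : ι → Type*} {g : ∀ i, List B → X i}
    (hg : ∀ i, IsRegularFun (g i)) : IsRegularFun fun w i => g i w := by
  refine ((Set.Finite.pi' fun i => hg i).image (fun ρ y i => ρ i y)).subset ?_
  rintro _ ⟨u, rfl⟩
  exact ⟨fun i y => g i (u ++ y), fun i => ⟨u, rfl⟩, rfl⟩

theorem comap {g : List C → X} (hg : IsRegularFun g) (h : List B → List C)
    (happ : ∀ u v, h (u ++ v) = h u ++ h v) : IsRegularFun fun w => g (h w) := by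
  refine (hg.image (fun ρ y => ρ (h y))).subset ?_
  rintro _ ⟨u, rfl⟩
  exact ⟨_, ⟨h u, rfl⟩, by funext y; simp [happ]⟩

theorem const (x : X) : IsRegularFun fun _ : List B => x :=
  of_state (fun _ => ()) (Set.toFinite _) (fun _ _ _ _ => rfl) (fun _ _ _ => rfl)

theorem of_hom {M : Type*} [Monoid M] [Finite M] (μ : FreeMonoid B →* M) :
    IsRegularFun fun w => μ (FreeMonoid.ofList w) := by
  refine of_state (fun w => μ (FreeMonoid.ofList w)) (Set.toFinite _) ?_ (fun _ _ h => h)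
  intro u u' b h
  simp only [FreeMonoid.ofList_append, map_mul, h]

theorem forall_mem (p : B → Prop) : IsRegularFun fun w => ∀ b ∈ w, p b := by
  refine of_state (fun w => ∀ b ∈ w, p b) (Set.toFinite _) ?_ (fun _ _ h => h)
  intro u u' b h
  simp only [List.mem_append, or_imp, forall_and, h]

/-- A regular function is recognized by a finite monoid. -/
theorem exists_monoid (hg : IsRegularFun g) :
    ∃ (M : Type) (_ : Monoid M) (_ : Finite M) (μ : FreeMonoid B →* M) (out : M → X),
      ∀ w, g w = out (μ (FreeMonoid.ofList w)) := by
  set R : Set (List B → X) := Set.range fun u y => g (u ++ y) with hR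
  have hfin : Finite R := hg
  -- Numbering the residuals places the transition monoid in `Type`, as `PebbleComputable` demands.
  obtain ⟨n, ⟨e⟩⟩ := Finite.exists_equiv_fin R
  have hact : ∀ (w : List B) (ρ : R), (fun y => ρ.1 (w ++ y)) ∈ R := by
    rintro w ⟨_, u, rfl⟩
    exact ⟨u ++ w, by funext y; simp⟩
  let act : List B → R → R := fun w ρ => ⟨_, hact w ρ⟩
  have hnil : ∀ ρ, act [] ρ = ρ := fun ρ => rfl
  have happ : ∀ w w' ρ, act (w ++ w') ρ = act w' (act w ρ) := by
    intro w w' ρ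
    apply Subtype.ext
    funext y
    simp [act]
  let E : List B → Function.End (Fin n) := fun w i => e (act w (e.symm i))
  have hE : ∀ w w', E (w ++ w') = E w' * E w := by
    intro w w'
    funext i
    change e (act (w ++ w') (e.symm i)) = e (act w' (e.symm (e (act w (e.symm i)))))
    rw [happ, Equiv.symm_apply_apply]
  have hfinE : Finite (Function.End (Fin n)) := inferInstanceAs (Finite (Fin n → Fin n))
  -- Words act on residuals from the right, hence the opposite monoid. The output is the value at
  -- the empty word of the residual reached from `g`.
  refine ⟨(Function.End (Fin n))ᵐᵒᵖ, inferInstance, Finite.of_equiv _ MulOpposite.opEquiv,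
    { toFun := fun w => MulOpposite.op (E w.toList)
      map_one' := ?_
      map_mul' := ?_ }, fun m => (e.symm (m.unop (e ⟨g, [], rfl⟩))).1 [], ?_⟩
  · apply MulOpposite.unop_injective
    funext i
    change e (act [] (e.symm i)) = i
    rw [hnil, Equiv.apply_symm_apply]
  · intro w w'
    rw [FreeMonoid.toList_mul, hE, MulOpposite.op_mul]
  · intro w
    change g w = (e.symm (e (act w (e.symm (e ⟨g, [], rfl⟩))))).1 []
    simp [act]

end IsRegularFun

/-! ## Sums of regular functions over tuples of marked positions -/

/-- The word `w` in which the letter in position `p` (counted from `o`) carries, for each member `i`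
of `v`, the truth value of `i = p`. -/
def tagFrom {B : Type*} (v : List ℕ) : ℕ → List B → List (B × List Bool)
  | _, [] => []
  | o, b :: w => (b, v.map (· == o)) :: tagFrom v (o + 1) w

@[simp]
theorem length_tagFrom {B : Type*} (v : List ℕ) (o : ℕ) (w : List B) :
    (tagFrom v o w).length = w.length := by
  induction w generalizing o with
  | nil => rfl
  | cons b w ih => simp [tagFrom, ih]

@[simp]
theorem getElem_tagFrom {B : Type*} (v : List ℕ) (o : ℕ) (w : List B) (p : ℕ)
    (hp : p < (tagFrom v o w).length) :
    (tagFrom v o w)[p] = (w[p]'(by simpa using hp), v.map (· == o + p)) := by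
  induction w generalizing o p with
  | nil => simp at hp
  | cons b w ih =>
    cases p with
    | zero => simp [tagFrom]
    | succ p => simp [tagFrom, ih, Nat.add_assoc, Nat.add_comm 1 p]

theorem map_fst_tagFrom {B : Type*} (v : List ℕ) (o : ℕ) (w : List B) :
    (tagFrom v o w).map Prod.fst = w := by
  apply List.ext_getElem <;> simp

/-- The lists of length `k` with members below `n`. -/
def tuples (n : ℕ) : ℕ → Finset (List ℕ)
  | 0 => {[]}
  | k + 1 => (Finset.range n ×ˢ tuples n k).image fun p => p.1 :: p.2

theorem mem_tuples {n k : ℕ} {v : List ℕ} :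
    v ∈ tuples n k ↔ v.length = k ∧ ∀ i ∈ v, i < n := by
  induction k generalizing v with
  | zero => cases v <;> simp [tuples]
  | succ k ih =>
    cases v with
    | nil => simp [tuples]
    | cons i v =>
      simp only [tuples, Finset.mem_image, Finset.mem_product, Finset.mem_range, ih, Prod.exists,
        List.cons.injEq, List.length_cons, List.mem_cons, forall_eq_or_imp]
      constructor
      · rintro ⟨_, _, ⟨h1, h2, h3⟩, rfl, rfl⟩
        exact ⟨by omega, h1, h3⟩
      · rintro ⟨h1, h2, h3⟩
        exact ⟨i, v, ⟨h2, by omega, h3⟩, rfl, rfl⟩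

theorem sum_tuples_succ (n k : ℕ) (f : List ℕ → ℕ) :
    ∑ v ∈ tuples n (k + 1), f v = ∑ i ∈ Finset.range n, ∑ v ∈ tuples n k, f (i :: v) := by
  rw [tuples, Finset.sum_image (by
    rintro ⟨i, v⟩ _ ⟨j, v'⟩ _ h
    simpa using h), Finset.sum_product]

-- Pebbles as tags

section MarkAt

variable {B : Type u}

@[simp]
theorem length_markAt (w : List B) (i : Fin w.length) : (markAt w i).length = w.length := by
  have := i.2
  simp [markAt]
  omega

theorem getElem_markAt (w : List B) (i : Fin w.length) (p : ℕ) (hp : p < (markAt w i).length) :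
    (markAt w i)[p] = if p = i then Sum.inr (w[p]'(by simpa using hp))
      else Sum.inl (w[p]'(by simpa using hp)) := by
  have hi := i.2
  have hp' : p < w.length := by simpa using hp
  rcases lt_trichotomy p i with h | h | h
  · simp only [markAt]
    rw [List.getElem_append_left (by simp; omega)]
    simp [h.ne]
  · subst h
    simp only [markAt]
    rw [List.getElem_append_right (by simp)]
    simp
  · simp only [markAt]
    obtain ⟨d, rfl⟩ := Nat.exists_eq_add_of_lt h
    rw [List.getElem_append_right (by simp; omega)]
    have hm : min (i : ℕ) w.length = i := min_eq_left hi.le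
    have : (i : ℕ) + d + 1 - ((w.take i).map (Sum.inl : B → B ⊕ B)).length = d + 1 := by
      simp; omega
    simp only [this, List.getElem_cons_succ, List.getElem_map, List.getElem_drop]
    rw [if_neg (by omega)]
    congr 2
    omega

/-- The letter map that turns a mark into a new first tag. -/
def pushMark : (B ⊕ B) × List Bool → B × List Bool
  | (Sum.inl b, t) => (b, false :: t)
  | (Sum.inr b, t) => (b, true :: t)

theorem tagFrom_cons_eq_map_markAt (w : List B) (i : Fin w.length) (v : List ℕ) :
    tagFrom ((i : ℕ) :: v) 0 w = (tagFrom v 0 (markAt w i)).map pushMark := by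
  apply List.ext_getElem
  · simp
  · intro p h1 h2
    simp only [getElem_tagFrom, List.getElem_map, getElem_markAt, List.map_cons]
    split_ifs with h
    · simp [pushMark, h]
    · simp [pushMark, Ne.symm h]

/-- The monoid value of the marked word is the product of the values of the prefix, the marked
letter and the suffix, which is what a bimachine sees at that position. -/
theorem pebbleComputable_one_of_isRegularFun (G : List (B ⊕ B) → ℕ) (hG : IsRegularFun G) :
    PebbleComputable 1 fun w : List B => ∑ i : Fin w.length, G (markAt w i) := by
  obtain ⟨M, _, _, μ, out, h⟩ := hG.exists_monoid
  refine ⟨M, inferInstance, inferInstance, μ.comp (FreeMonoid.map Sum.inl),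
    fun m a m' _ => out (m * μ (FreeMonoid.of (Sum.inr a)) * m'),
    fun m a m' => ⟨_, fun _ => rfl⟩, ?_⟩
  intro w
  refine Finset.sum_congr rfl fun i _ => ?_
  rw [h, markAt, FreeMonoid.ofList_append, FreeMonoid.ofList_cons, map_mul, map_mul, ← mul_assoc]
  rfl

/-- Induction on the number of pebbles: the outermost pebble fixes the head of the tuple, and
`pushMark` turns its mark into the first tag. The alphabet varies, since each pebble doubles it. -/
theorem pebbleComputable_sum_tuples (k : ℕ) {B : Type u} (G : List (B × List Bool) → ℕ)
    (hG : IsRegularFun G) :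
    PebbleComputable (k + 1) fun w : List B =>
      ∑ v ∈ tuples w.length (k + 1), G (tagFrom v 0 w) := by
  induction k generalizing B with
  | zero =>
    have hG' : IsRegularFun fun w : List (B ⊕ B) => G ((tagFrom [] 0 w).map pushMark) := by
      -- Without tuple members every tag list is empty, so `tagFrom [] 0` acts letter by letter.
      refine hG.comap (fun w => (tagFrom [] 0 w).map pushMark) fun u v => ?_
      apply List.ext_getElem
      · simp
      · intro p h1 h2
        simp only [List.getElem_map, getElem_tagFrom, List.map_nil, List.getElem_append,
          List.length_map, length_tagFrom]
        split_ifs <;> rfl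
    convert pebbleComputable_one_of_isRegularFun _ hG' using 2 with w
    rw [sum_tuples_succ, Finset.sum_range]
    simp [tuples, tagFrom_cons_eq_map_markAt]
  | succ k ih =>
    -- The outer bimachine makes no choice, so the trivial monoid suffices.
    refine ⟨Unit, inferInstance, inferInstance, 1, fun _ _ _ w =>
      ∑ v ∈ tuples w.length (k + 1), G ((tagFrom v 0 w).map pushMark), fun _ _ _ => ?_, ?_⟩
    · exact ih (fun w => G (w.map pushMark)) (hG.comap _ fun u v => by simp)
    · intro w
      beta_reduce
      rw [sum_tuples_succ, Finset.sum_range]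
      refine Finset.sum_congr rfl fun i _ => ?_
      simp [tagFrom_cons_eq_map_markAt]

end MarkAt

/-! ## Trees: induction, relabelling, decompositions -/

namespace FactForest

variable {A : Type u} {L : Type*}

@[elab_as_elim]
theorem induction_on_children {p : FactForest A → Prop} (F : FactForest A)
    (leaf : ∀ a, p (leaf a)) (node : ∀ cs, (∀ c ∈ cs, p c) → p (node cs)) : p F := by
  refine FactForest.rec (motive_1 := p) (motive_2 := fun cs => ∀ c ∈ cs, p c) leaf node ?_ ?_ F
  · simp
  · intro c cs hc hcs
    simpa using ⟨hc, hcs⟩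

theorem yieldList_eq (cs : List (FactForest A)) : yieldList cs = cs.flatMap yield := by
  induction cs with
  | nil => simp [yieldList]
  | cons c cs ih => simp [yieldList, ih]

theorem encodeList_eq (cs : List (FactForest A)) :
    encodeList cs = cs.flatMap fun c => Bracketed.op :: (encode c ++ [Bracketed.cl]) := by
  induction cs with
  | nil => simp [encodeList]
  | cons c cs ih => simp [encodeList, ih]

@[simp]
theorem yieldList_append (cs ds : List (FactForest A)) :
    yieldList (cs ++ ds) = yieldList cs ++ yieldList ds := by
  simp [yieldList_eq]

theorem encodeList_append (cs ds : List (FactForest A)) :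
    encodeList (cs ++ ds) = encodeList cs ++ encodeList ds := by
  simp [encodeList_eq]

theorem heightList_le {cs : List (FactForest A)} {h : ℕ} :
    heightList cs ≤ h ↔ ∀ c ∈ cs, c.height + 1 ≤ h := by
  induction cs with
  | nil => simp [heightList]
  | cons c cs ih => simp [heightList, ih]

/-! ## Parsing with a stack of bounded height -/

/-- One step of the parser. The state is the stack of the trees that are being built, the innermost
first, or `none` after an error. An opening bracket must find a stack of length at most `K`. -/
def parseStep (K : ℕ) : Option (List (FactForest A)) → Bracketed A → Option (List (FactForest A))
  | some (node [] :: st), Bracketed.letter a => some (leaf a :: st)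
  | some (node cs :: st), Bracketed.op =>
      if st.length < K then some (node [] :: node cs :: st) else none
  | some (c :: node cs :: st), Bracketed.cl => some (node (cs ++ [c]) :: st)
  | _, _ => none

/-- The state of the parser after reading a word. -/
def parse (K : ℕ) (x : List (Bracketed A)) : Option (List (FactForest A)) :=
  x.foldl (parseStep K) (some [node []])

/-- The word read by the parser, recovered from its stack. -/
def unparse : List (FactForest A) → List (Bracketed A)
  | [] => []
  | [c] => encode c
  | c :: d :: st => unparse (d :: st) ++ Bracketed.op :: encode c

/-- The prefix `p` does not depend on the top of the stack, so a parser step that changes only the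
top changes only the end of the word. -/
theorem unparse_cons (st : List (FactForest A)) :
    ∃ p, ∀ c : FactForest A, unparse (c :: st) = p ++ encode c := by
  cases st with
  | nil => exact ⟨[], fun c => by simp [unparse]⟩
  | cons d st => exact ⟨unparse (d :: st) ++ [Bracketed.op], fun c => by simp [unparse]⟩

theorem parse_append_singleton (K : ℕ) (x : List (Bracketed A)) (b : Bracketed A) :
    parse K (x ++ [b]) = parseStep K (parse K x) b := by
  simp [parse]

/-- The members of a stack, at their depths, respect the height `K`. -/
def StackHeight (K : ℕ) : List (FactForest A) → Prop
  | [] => True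
  | c :: st => c.height + st.length ≤ K ∧ StackHeight K st

/-- Invariant of the parser: the stack retains the whole word read, and a tree under construction at
depth `d` has height at most `K - d`. -/
theorem parse_sound (K : ℕ) (x : List (Bracketed A)) (st : List (FactForest A))
    (h : parse K x = some st) : unparse st = x ∧ StackHeight K st := by
  induction x using List.reverseRecOn generalizing st with
  | nil =>
    simp only [parse, List.foldl_nil, Option.some.injEq] at h
    subst h
    simp [unparse, encode, encodeList, StackHeight, height, heightList]
  | append_singleton x b ih =>
    rw [parse_append_singleton] at h
    cases hp : parse K x with
    | none => simp [hp, parseStep] at h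
    | some st0 =>
      obtain ⟨h1, h2⟩ := ih st0 hp
      rw [hp] at h
      unfold parseStep at h
      split at h
      · next st' a heq =>
        cases heq
        cases h
        obtain ⟨p, hp'⟩ := unparse_cons st'
        rw [hp'] at h1 ⊢
        simp only [StackHeight, height, heightList] at h2 ⊢
        exact ⟨by simpa [encode, encodeList] using h1, h2⟩
      · next cs st' heq =>
        cases heq
        split_ifs at h with hK
        cases h
        simp only [StackHeight, height, heightList, List.length_cons] at h2 ⊢
        exact ⟨by simp [unparse, h1, encode, encodeList], by omega, h2⟩
      · next c cs st' heq =>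
        cases heq
        cases h
        obtain ⟨p, hp'⟩ := unparse_cons st'
        rw [unparse, hp'] at h1
        rw [hp', ← h1]
        simp only [StackHeight, height, List.length_cons] at h2 ⊢
        refine ⟨by simp [encode, encodeList_append, encodeList], ?_, h2.2.2⟩
        have h3 : heightList cs ≤ K - st'.length := by omega
        rw [heightList_le] at h3
        have h4 : heightList (cs ++ [c]) ≤ K - st'.length := by
          rw [heightList_le]
          intro d hd
          rcases List.mem_append.1 hd with hd | hd
          · exact h3 d hd
          · rw [List.mem_singleton] at hd
            subst hd
            omega
        omega
      · cases h

/-- Completeness of the parser: within the height bound no opening bracket is rejected, and the rest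
of the stack is untouched. -/
theorem foldl_parseStep_encode (K : ℕ) (F : FactForest A) : ∀ st : List (FactForest A),
    F.height + st.length ≤ K →
    (encode F).foldl (parseStep K) (some (node [] :: st)) = some (F :: st) := by
  refine induction_on_children F ?_ ?_
  · intro a st _
    simp [encode, parseStep]
  · intro cs ih st hK
    -- Generalized over the children `ds` already attached, for the induction on the remaining ones.
    have key : ∀ ds, (encodeList cs).foldl (parseStep K) (some (node ds :: st)) =
        some (node (ds ++ cs) :: st) := by
      rw [height] at hK
      have hK' : heightList cs ≤ K - st.length := by omega
      clear hK
      induction cs with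
      | nil => intro ds; simp [encodeList]
      | cons c cs ih' =>
        intro ds
        rw [heightList_le] at hK'
        have hc := hK' c (by simp)
        simp only [encodeList, List.foldl_cons, List.foldl_append]
        rw [show parseStep K (some (node ds :: st)) Bracketed.op =
          some (node [] :: node ds :: st) by simp [parseStep]; omega]
        rw [ih c (by simp) (node ds :: st) (by simp; omega)]
        rw [show parseStep K (some (c :: node ds :: st)) Bracketed.cl =
          some (node (ds ++ [c]) :: st) by cases c <;> simp [parseStep]]
        rw [ih' (fun c hc => ih c (by simp [hc])) (by
          rw [heightList_le]; exact fun c hc => hK' c (by simp [hc]))]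
        simp
    simpa [encode] using key []

theorem parse_eq_some_singleton {K : ℕ} {x : List (Bracketed A)} {F : FactForest A} :
    parse K x = some [F] ↔ encode F = x ∧ F.height ≤ K := by
  constructor
  · intro h
    have := parse_sound K x _ h
    simpa [unparse, StackHeight] using this
  · rintro ⟨rfl, h⟩
    exact foldl_parseStep_encode K F [] (by simpa using h)

theorem parse_length_le (K : ℕ) (x : List (Bracketed A)) (st : List (FactForest A))
    (h : parse K x = some st) : st.length ≤ K + 1 := by
  have := (parse_sound K x st h).2
  cases st with
  | nil => simp
  | cons c st => simp only [StackHeight, List.length_cons] at this ⊢; omega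

-- Bottom-up evaluation by a finite automaton

section Fold

variable {S σ : Type*} (φ : FactForest A → S) (r : List (FactForest A) → σ)

/-- The list of children of a tree. -/
def children : FactForest A → List (FactForest A)
  | leaf _ => []
  | node cs => cs

/-- The finite information on a tree in the stack of the parser. -/
def summary : FactForest A → S ⊕ (Prop × σ)
  | leaf a => Sum.inl (φ (leaf a))
  | node cs => Sum.inr (cs = [], r cs)

/-- Values of trees that are computed bottom-up, by a finite automaton in each list of children, are
computed from encodings of trees of bounded height by a finite automaton. -/
theorem isRegularFun_of_fold [Finite S] [Finite σ]
    (step : σ → S → σ) (hstep : ∀ cs c, r (cs ++ [c]) = step (r cs) (φ c))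
    (out : σ → S) (hout : ∀ cs, φ (node cs) = out (r cs)) (K : ℕ) :
    ∃ G : List (Bracketed A) → Option S, IsRegularFun G ∧
      ∀ x s, G x = some s ↔ ∃ F : FactForest A, encode F = x ∧ F.height ≤ K ∧ φ F = s := by
  classical
  let val : S ⊕ (Prop × σ) → S := Sum.elim id fun q => out q.2
  have hval : ∀ F, φ F = val (summary φ r F) := by
    intro F
    cases F with
    | leaf a => rfl
    | node cs => exact hout cs
  let fin : Option (List (S ⊕ (Prop × σ))) → Option S
    | some [s] => some (val s)
    | _ => none
  let st : List (Bracketed A) → Option (List (S ⊕ (Prop × σ))) := fun x =>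
    (parse K x).map (List.map (summary φ r))
  -- Of a tree, the parser inspects only whether it is a leaf and whether its list of children is
  -- empty. Summaries record both, so the parser descends to stacks of summaries.
  let astep : Option (List (S ⊕ (Prop × σ))) → Bracketed A → Option (List (S ⊕ (Prop × σ)))
    | some (Sum.inr q :: st), Bracketed.letter a =>
        if q.1 then some (Sum.inl (φ (leaf a)) :: st) else none
    | some (Sum.inr q :: st), Bracketed.op =>
        if st.length < K then some (Sum.inr (True, r []) :: Sum.inr q :: st) else none
    | some (s :: Sum.inr q :: st), Bracketed.cl =>
        some (Sum.inr (False, step q.2 (val s)) :: st)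
    | _, _ => none
  have hastep : ∀ s b, (parseStep K s b).map (List.map (summary φ r)) =
      astep (s.map (List.map (summary φ r))) b := by
    intro s b
    rcases s with _ | s
    · simp [parseStep, astep]
    rcases s with _ | ⟨c, s⟩
    · simp [parseStep, astep]
    rcases b with a | _ | _
    · rcases c with a' | cs
      · simp [parseStep, astep, summary]
      · cases cs <;> simp [parseStep, astep, summary]
    · rcases c with a' | cs
      · simp [parseStep, astep, summary]
      · by_cases h : s.length < K <;> simp [parseStep, astep, summary, h]
    · rcases s with _ | ⟨d, s⟩
      · cases c <;> simp [parseStep, astep, summary]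
      · have h : summary φ r (node (children d ++ [c])) =
            Sum.inr (False, step (r (children d)) (val (summary φ r c))) := by
          simp [summary, hstep, hval c]
        rcases d with a' | ds
        · cases c <;> simp [parseStep, astep, summary]
        · cases c <;> simpa [parseStep, astep, summary, children] using h
  refine ⟨fun x => fin (st x), IsRegularFun.of_state st ?_ ?_ ?_, ?_⟩
  -- The bound on the height enters here: stacks have at most `K + 1` members from a finite set.
  · have hf := (List.finite_length_le (S ⊕ (Prop × σ)) (K + 1)).image some
    refine (hf.union (Set.finite_singleton none)).subset ?_
    rintro _ ⟨x, rfl⟩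
    cases h : parse K x with
    | none => simp [st, h]
    | some s =>
      left
      exact ⟨s.map (summary φ r), by simpa using parse_length_le K x s h, by simp [st, h]⟩
  · intro u u' b h
    simp only [st, parse_append_singleton, hastep] at h ⊢
    rw [h]
  · intro u u' h
    simp only [h]
  · intro x s
    have h1 : fin (st x) = some s ↔ ∃ F, parse K x = some [F] ∧ φ F = s := by
      simp only [st]
      rcases parse K x with _ | s
      · simp [fin]
      rcases s with _ | ⟨c, s⟩
      · simp [fin]
      rcases s with _ | ⟨d, s⟩
      · simp [fin, hval]
      · simp [fin]
    rw [h1]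
    simp only [parse_eq_some_singleton, and_assoc]

end Fold

end FactForest

/-! ## Productions are regular functions of the tagged word -/

section Split

variable {B X Y Z : Type*}

open Classical in
/-- The value `out (φ (y₁ b)) (ψ y₂)` for the factorization `y₁ b y₂` of the input at the first letter
`b` with the property `p`, where `pre` has already been read. -/
noncomputable def splitAtFirst (p : B → Prop) (φ : List B → X) (ψ : List B → Y) (out : X → Y → Z)
    (z : Z) : List B → List B → Z
  | _, [] => z
  | pre, b :: y => if p b then out (φ (pre ++ [b])) (ψ y) else
      splitAtFirst p φ ψ out z (pre ++ [b]) y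

variable (p : B → Prop) (φ : List B → X) (ψ : List B → Y) (out : X → Y → Z) (z : Z)

theorem splitAtFirst_of_forall_not (pre y : List B) (h : ∀ b ∈ y, ¬ p b) :
    splitAtFirst p φ ψ out z pre y = z := by
  induction y generalizing pre with
  | nil => rfl
  | cons b y ih =>
    rw [splitAtFirst, if_neg (h b (by simp)), ih _ fun c hc => h c (by simp [hc])]

theorem splitAtFirst_append_cons (pre y : List B) (b : B) (y' : List B) (h : ∀ b ∈ y, ¬ p b)
    (hb : p b) : splitAtFirst p φ ψ out z pre (y ++ b :: y') = out (φ (pre ++ y ++ [b])) (ψ y') := by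
  induction y generalizing pre with
  | nil => simp [splitAtFirst, hb]
  | cons c y ih =>
    rw [List.cons_append, splitAtFirst, if_neg (h c (by simp)),
      ih _ fun c hc => h c (by simp [hc])]
    simp

theorem forall_not_or_exists_first (y : List B) :
    (∀ b ∈ y, ¬ p b) ∨ ∃ y₁ b y₂, y = y₁ ++ b :: y₂ ∧ (∀ b ∈ y₁, ¬ p b) ∧ p b := by
  induction y with
  | nil => simp
  | cons b y ih =>
    by_cases hb : p b
    · exact Or.inr ⟨[], b, y, by simp, by simp, hb⟩
    rcases ih with h | ⟨y₁, c, y₂, rfl, h1, h2⟩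
    · exact Or.inl (by simpa [hb] using h)
    · exact Or.inr ⟨b :: y₁, c, y₂, by simp, by simpa [hb] using h1, h2⟩

/-- Before the first letter with `p`, the residual of `φ` determines the future; afterwards the
value of `φ` up to that letter and the residual of `ψ` do. The sum type keeps the two phases apart.
-/
theorem isRegularFun_splitAtFirst (hφ : IsRegularFun φ) (hψ : IsRegularFun ψ) :
    IsRegularFun (splitAtFirst p φ ψ out z []) := by
  classical
  set g := splitAtFirst p φ ψ out z [] with hg
  refine IsRegularFun.of_residual (fun u => if ∀ b ∈ u, ¬ p b then
    (Sum.inl fun y => φ (u ++ y) : (List B → X) ⊕ (List B → Z)) else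
    Sum.inr fun y => g (u ++ y)) ?_ ?_
  · refine ((Set.Finite.image Sum.inl hφ).union (Set.Finite.image Sum.inr
      (Set.Finite.image2 (fun x ρ y => out x (ρ y)) hφ.finite_range hψ))).subset ?_
    rintro _ ⟨u, rfl⟩
    dsimp only
    split_ifs with h
    · exact Or.inl ⟨_, ⟨u, rfl⟩, rfl⟩
    · right
      rcases forall_not_or_exists_first p u with h' | ⟨u₁, b, u₂, rfl, h1, h2⟩
      · exact absurd h' h
      refine ⟨_, ⟨φ (u₁ ++ [b]), ⟨_, rfl⟩, _, ⟨u₂, rfl⟩, rfl⟩, ?_⟩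
      congr 1
      funext y
      rw [hg, List.append_assoc, List.cons_append, splitAtFirst_append_cons p φ ψ out z [] u₁ b _ h1 h2]
      simp
  · intro u u' h y
    split_ifs at h with h1 h2 h2
    · rw [Sum.inl.injEq] at h
      rcases forall_not_or_exists_first p y with h' | ⟨y₁, b, y₂, rfl, h3, h4⟩
      · rw [hg, splitAtFirst_of_forall_not, splitAtFirst_of_forall_not]
        · intro b hb; rcases List.mem_append.1 hb with hb | hb
          exacts [h2 b hb, h' b hb]
        · intro b hb; rcases List.mem_append.1 hb with hb | hb
          exacts [h1 b hb, h' b hb]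
      -- Equal residuals of `φ`, evaluated up to the splitting letter, give equal first arguments of
      -- `out`.
      · have := congrFun h (y₁ ++ [b])
        rw [hg, ← List.append_assoc, ← List.append_assoc, splitAtFirst_append_cons _ _ _ _ _ _ _ _ _ _ h4,
          splitAtFirst_append_cons _ _ _ _ _ _ _ _ _ _ h4]
        · simpa using congrArg (fun x => out x (ψ y₂)) this
        · intro b hb; rcases List.mem_append.1 hb with hb | hb
          exacts [h2 b hb, h3 b hb]
        · intro b hb; rcases List.mem_append.1 hb with hb | hb
          exacts [h1 b hb, h3 b hb]
    · exact congrFun (Sum.inr.inj h) y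

end Split

theorem tagFrom_append {B : Type*} (v : List ℕ) (o : ℕ) (w w' : List B) :
    tagFrom v o (w ++ w') = tagFrom v o w ++ tagFrom v (o + w.length) w' := by
  induction w generalizing o with
  | nil => simp [tagFrom]
  | cons b w ih => simp [tagFrom, ih, Nat.add_assoc, Nat.add_comm 1]

theorem map_tail_tagFrom {B : Type*} (i : ℕ) (v : List ℕ) (o : ℕ) (w : List B) :
    (tagFrom (i :: v) o w).map (fun b => (b.1, b.2.tail)) = tagFrom v o w := by
  apply List.ext_getElem <;> simp

namespace MarbleBimachine

variable {A : Type u}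

/-- The outermost machine calls its submachine at the head of `v`, that is, at the first letter
whose first tag is true. The prefix ending there, with first tags removed, is the tagged input of
the submachine, so the induction hypothesis applies to it. -/
theorem exists_isRegularFun_prodList [Finite A] {k : ℕ} (N : MarbleBimachine.{u, v} A k) :
    ∃ P : List (A × List Bool) → ℕ, IsRegularFun P ∧
      ∀ w v, v.length = k → P (tagFrom v 0 w) = N.prodList w v := by
  induction N with
  | const c =>
    refine ⟨fun _ => c, IsRegularFun.const c, fun w v hv => ?_⟩
    rw [List.length_eq_zero_iff] at hv
    subst hv
    rfl
  | @node k M _ _ μ out ih =>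
    choose P hP hP' using ih
    let hom : FreeMonoid (A × List Bool) →* M := μ.comp (FreeMonoid.map Prod.fst)
    have hhom : ∀ y : List (A × List Bool), hom (FreeMonoid.ofList y) =
      μ (FreeMonoid.ofList (y.map Prod.fst)) := fun y => rfl
    -- The choice of the submachine also depends on the value `m'` of the suffix, not yet read; the
    -- prefix thus yields a function of `m'`.
    let φ : List (A × List Bool) → M → ℕ := fun y m' =>
      (fun t : (Option A × M) × (M → A → M → ℕ) =>
        match t.1.1 with
        | some a => t.2 t.1.2 a m'
        | none => 0) ((y.getLast?.map Prod.fst, hom (FreeMonoid.ofList y.dropLast)),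
          fun m a m' => P m a m' (y.map fun b => (b.1, b.2.tail)))
    have hφ : IsRegularFun φ := by
      refine IsRegularFun.pi fun m' => IsRegularFun.comp (IsRegularFun.prodMk ?_ ?_)
        (fun t : (Option A × M) × (M → A → M → ℕ) =>
          match t.1.1 with
          | some a => t.2 t.1.2 a m'
          | none => 0)
      -- The value of the whole word is added to the state because it is the value without the last
      -- letter after the next step.
      · refine IsRegularFun.of_state (fun y => (y.getLast?.map Prod.fst,
          hom (FreeMonoid.ofList y.dropLast), hom (FreeMonoid.ofList y))) (Set.toFinite _) ?_ ?_
        · intro u u' b h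
          simp only [Prod.mk.injEq] at h
          simp [FreeMonoid.ofList_append, h.2.2]
        · intro u u' h
          simp only [Prod.mk.injEq] at h ⊢
          exact ⟨h.1, h.2.1⟩
      · exact IsRegularFun.pi fun m => IsRegularFun.pi fun a => IsRegularFun.pi fun m' =>
          (hP m a m').comap _ fun u v => by simp
    let p : A × List Bool → Prop := fun b => b.2.head? = some true
    refine ⟨splitAtFirst p φ (fun y => hom (FreeMonoid.ofList y)) (fun f m' => f m') 0 [],
      isRegularFun_splitAtFirst _ _ _ _ _ hφ (IsRegularFun.of_hom hom), ?_⟩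
    intro w v hv
    obtain ⟨i, v, rfl⟩ := List.exists_cons_of_length_eq_add_one hv
    simp only [List.length_cons, Nat.add_right_cancel_iff] at hv
    have hno : ∀ w' : List A, w'.length ≤ i → ∀ b ∈ tagFrom (i :: v) 0 w', ¬ p b := by
      intro w' hw' b hb
      obtain ⟨q, hq, rfl⟩ := List.getElem_of_mem hb
      rw [length_tagFrom] at hq
      simp [p]
      omega
    by_cases hi : i < w.length
    · have hw : w = w.take i ++ w[i] :: w.drop (i + 1) := by simp
      have hlen : (w.take i).length = i := by simp; omega
      have ht : tagFrom (i :: v) 0 w = tagFrom (i :: v) 0 (w.take i) ++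
          (w[i], true :: v.map (· == i)) :: tagFrom (i :: v) (i + 1) (w.drop (i + 1)) := by
        conv_lhs => rw [hw]
        rw [tagFrom_append, hlen]
        simp [tagFrom]
      have ht' : tagFrom v 0 (w.take (i + 1)) =
          (tagFrom (i :: v) 0 (w.take i) ++ [(w[i], true :: v.map (· == i))]).map
            (fun b => (b.1, b.2.tail)) := by
        rw [List.map_append, map_tail_tagFrom, List.take_succ_eq_append_getElem hi, tagFrom_append,
          hlen]
        simp [tagFrom]
      rw [ht, splitAtFirst_append_cons _ _ _ _ _ _ _ _ _ (hno _ hlen.le) (by simp [p])]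
      simp only [prodList, List.getElem?_eq_getElem hi]
      rw [← hP' _ _ _ _ _ hv, ht']
      simp only [φ, List.nil_append, List.getLast?_append, List.getLast?_singleton, Option.some_or,
        Option.map_some, List.dropLast_concat, hhom, map_fst_tagFrom]
    · rw [splitAtFirst_of_forall_not _ _ _ _ _ _ _ (hno w (by omega))]
      simp only [prodList, List.getElem?_eq_none (not_lt.1 hi)]

/-- The output function has a finite domain, so only finitely many submachine bounds occur. -/
theorem exists_prodList_le [Finite A] {k : ℕ} (N : MarbleBimachine.{u, v} A k) :
    ∃ C, ∀ w v, N.prodList w v ≤ C := by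
  induction N with
  | const c =>
    refine ⟨c, fun w v => ?_⟩
    cases v <;> simp [prodList]
  | @node k M _ _ μ out ih =>
    choose C hC using ih
    obtain ⟨D, hD⟩ := (Set.finite_range fun t : M × A × M => C t.1 t.2.1 t.2.2).bddAbove
    refine ⟨D, fun w v => ?_⟩
    cases v with
    | nil => simp [prodList]
    | cons i v =>
      simp only [prodList]
      split
      · exact (hC _ _ _ _ _).trans (hD ⟨(_, _, _), rfl⟩)
      · exact Nat.zero_le _

/-- A nonzero production needs a weakly decreasing list of positions. -/
theorem prodList_ne_zero {k : ℕ} (N : MarbleBimachine.{u, v} A k) (w : List A) (v : List ℕ)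
    (h : N.prodList w v ≠ 0) : v.Pairwise (· ≥ ·) ∧ ∀ i ∈ v, i < w.length := by
  induction N generalizing w v with
  | const c =>
    cases v with
    | nil => simp
    | cons i v => simp [prodList] at h
  | @node k M _ _ μ out ih =>
    cases v with
    | nil => simp
    | cons i v =>
      simp only [prodList] at h
      split at h
      · next a ha =>
        obtain ⟨hi, rfl⟩ := List.getElem?_eq_some_iff.1 ha
        obtain ⟨h1, h2⟩ := ih _ _ _ _ _ h
        simp only [List.length_take] at h2
        refine ⟨List.pairwise_cons.2 ⟨fun j hj => ?_, h1⟩, ?_⟩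
        · have := h2 j hj; omega
        · simp only [List.mem_cons, forall_eq_or_imp]
          exact ⟨hi, fun j hj => (h2 j hj).trans_le (by omega)⟩
      · simp at h

end MarbleBimachine

/-! ## The node whose frontier contains a given position -/

namespace FactForest

variable {A : Type u}

mutual
/-- The node, iterable or the root, whose frontier contains the position `i`. -/
def owner : FactForest A → ℕ → List ℕ
  | leaf _, _ => []
  | node cs, i => ownerFrom cs.length 0 cs i
/-- The same for a position in the last siblings, numbered from `j`, among `n` siblings. -/
def ownerFrom (n j : ℕ) : List (FactForest A) → ℕ → List ℕ
  | [], _ => []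
  | c :: cs, i =>
    if i < (yield c).length then
      if owner c i = [] ∧ (j = 0 ∨ j + 1 = n) then [] else j :: owner c i
    else ownerFrom n (j + 1) cs (i - (yield c).length)
end

theorem ownerFrom_append_cons (n j : ℕ) (l r : List (FactForest A)) (c : FactForest A) (i : ℕ)
    (hi : i < c.yield.length) :
    ownerFrom n j (l ++ c :: r) ((yieldList l).length + i) =
      if owner c i = [] ∧ (j + l.length = 0 ∨ j + l.length + 1 = n) then []
      else (j + l.length) :: owner c i := by
  induction l generalizing j with
  | nil => simp [ownerFrom, yieldList, hi]
  | cons d l ih =>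
    rw [List.cons_append, ownerFrom, if_neg (by simp [yieldList]; omega)]
    have : (yieldList (d :: l)).length + i - d.yield.length = (yieldList l).length + i := by
      simp [yieldList]; omega
    rw [this, ih]
    simp [Nat.add_assoc, Nat.add_comm 1]

/-- The first and last children are not iterable and their skeletons belong to that of the parent,
which thus takes over the positions owned by their roots. All later facts on owners are inductions
along this equation. -/
theorem owner_node (l r : List (FactForest A)) (c : FactForest A) (i : ℕ)
    (hi : i < c.yield.length) :
    owner (node (l ++ c :: r)) ((yieldList l).length + i) =
      if owner c i = [] ∧ (l = [] ∨ r = []) then [] else l.length :: owner c i := by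
  rw [owner, ownerFrom_append_cons _ _ _ _ _ _ hi]
  have h1 : (0 + l.length = 0 ∨ 0 + l.length + 1 = (l ++ c :: r).length) ↔ (l = [] ∨ r = []) := by
    have h2 : 0 + l.length + 1 = (l ++ c :: r).length ↔ r = [] := by
      rw [← List.length_eq_zero_iff]; simp
    rw [h2]
    simp
  simp only [h1]
  simp

theorem exists_eq_append_cons {cs : List (FactForest A)} {i : ℕ} (hi : i < (yieldList cs).length) :
    ∃ l c r i', cs = l ++ c :: r ∧ i = (yieldList l).length + i' ∧ i' < c.yield.length := by
  induction cs generalizing i with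
  | nil => simp [yieldList] at hi
  | cons c cs ih =>
    by_cases h : i < c.yield.length
    · exact ⟨[], c, cs, i, by simp, by simp [yieldList], h⟩
    · obtain ⟨l, d, r, i', rfl, h1, h2⟩ := ih (i := i - c.yield.length) (by
        simp [yieldList] at hi; omega)
      exact ⟨c :: l, d, r, i', by simp, by simp [yieldList]; omega, h2⟩

theorem nil_notMem_iter (F : FactForest A) : [] ∉ F.iter := by
  have key : ∀ (cs : List (FactForest A)) j, [] ∉ iterFrom j cs := by
    intro cs
    induction cs with
    | nil => simp [iterFrom]
    | cons c cs ih => intro j; simp [iterFrom, ih]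
  cases F <;> simp [iter, key]

theorem mem_iterFrom {j : ℕ} {cs : List (FactForest A)} {t : List ℕ} :
    t ∈ iterFrom j cs ↔ ∃ l c r, cs = l ++ c :: r ∧ ∃ p ∈ iter c, t = (j + l.length) :: p := by
  induction cs generalizing j with
  | nil => simp [iterFrom]
  | cons c cs ih =>
    simp only [iterFrom, Finset.mem_union, Finset.mem_image, ih]
    constructor
    · rintro (⟨p, hp, rfl⟩ | ⟨l, d, r, rfl, p, hp, rfl⟩)
      · exact ⟨[], c, cs, rfl, p, hp, by simp⟩
      · exact ⟨c :: l, d, r, rfl, p, hp, by simp [Nat.add_assoc, Nat.add_comm 1]⟩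
    · rintro ⟨l, d, r, h, p, hp, rfl⟩
      rcases l with _ | ⟨e, l⟩
      · obtain ⟨rfl, rfl⟩ : c = d ∧ cs = r := by simpa using h
        exact Or.inl ⟨p, hp, by simp⟩
      · obtain ⟨rfl, rfl⟩ : c = e ∧ cs = l ++ d :: r := by simpa using h
        exact Or.inr ⟨l, d, r, rfl, p, hp, by simp [Nat.add_assoc, Nat.add_comm 1]⟩

theorem mem_iter_node {cs : List (FactForest A)} {t : List ℕ} :
    t ∈ iter (node cs) ↔ ∃ l c r, cs = l ++ c :: r ∧
      ((t = [l.length] ∧ l ≠ [] ∧ r ≠ []) ∨ ∃ p ∈ iter c, t = l.length :: p) := by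
  simp only [iter, Finset.mem_union, mem_iterFrom, Finset.mem_image, Finset.mem_Ioo, Nat.zero_add]
  constructor
  · rintro (⟨i, ⟨h1, h2⟩, rfl⟩ | ⟨l, c, r, rfl, h⟩)
    · have hi : i < cs.length := by omega
      have hlen : (cs.take i).length = i := by simp; omega
      refine ⟨cs.take i, cs[i], cs.drop (i + 1), by simp, Or.inl ⟨by rw [hlen], ?_, ?_⟩⟩
      · intro h
        rw [h, List.length_nil] at hlen
        omega
      · intro h
        have := congrArg List.length h
        rw [List.length_drop, List.length_nil] at this
        omega
    · exact ⟨l, c, r, rfl, Or.inr h⟩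
  · rintro ⟨l, c, r, rfl, ⟨rfl, h1, h2⟩ | h⟩
    · left
      rw [← List.length_pos_iff] at h1 h2
      exact ⟨_, ⟨h1, by simp; omega⟩, rfl⟩
    · exact Or.inr ⟨l, c, r, rfl, h⟩

theorem skeletonLeavesLast_concat (o : ℕ) (l : List (FactForest A)) (c : FactForest A) :
    skeletonLeavesLast o (l ++ [c]) = skeletonLeaves (o + (yieldList l).length) c := by
  induction l generalizing o with
  | nil => simp [skeletonLeavesLast, yieldList]
  | cons d l ih =>
    cases l with
    | nil => simp [skeletonLeavesLast, yieldList]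
    | cons e l =>
      rw [List.cons_append, List.cons_append, skeletonLeavesLast, ← List.cons_append, ih]
      simp [yieldList, Nat.add_assoc]

/-- The form `l ++ c :: r` with `l = []` or `r = []` treats first and last children alike, and
covers an only child, which is both. -/
theorem mem_skeletonLeaves_node {o i : ℕ} {cs : List (FactForest A)} :
    i ∈ skeletonLeaves o (node cs) ↔ ∃ l c r, cs = l ++ c :: r ∧ (l = [] ∨ r = []) ∧
      i ∈ skeletonLeaves (o + (yieldList l).length) c := by
  rcases cs with _ | ⟨c, cs⟩
  · simp [skeletonLeaves]
  simp only [skeletonLeaves, Finset.mem_union]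
  rcases List.eq_nil_or_concat cs with rfl | ⟨l, d, rfl⟩
  · simp only [skeletonLeavesLast, Finset.notMem_empty, or_false]
    constructor
    · intro h
      exact ⟨[], c, [], rfl, Or.inl rfl, by simpa [yieldList] using h⟩
    · rintro ⟨l, d, r, h, -, h'⟩
      have hl : l = [] := by
        have := congrArg List.length h
        simp at this
        exact List.length_eq_zero_iff.1 (by omega)
      subst hl
      obtain ⟨rfl, -⟩ : c = d ∧ [] = r := by simpa using h
      simpa [yieldList] using h'
  · rw [List.concat_eq_append, skeletonLeavesLast_concat]
    constructor
    · rintro (h | h)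
      · exact ⟨[], c, l ++ [d], rfl, Or.inl rfl, by simpa [yieldList] using h⟩
      · exact ⟨c :: l, d, [], rfl, Or.inr rfl, by simpa [yieldList, Nat.add_assoc] using h⟩
    · rintro ⟨l', d', r, h, rfl | rfl, h'⟩
      · obtain ⟨rfl, -⟩ : c = d' ∧ l ++ [d] = r := by simpa using h
        exact Or.inl (by simpa [yieldList] using h')
      · rw [← List.cons_append] at h
        obtain ⟨rfl, h2⟩ := List.append_inj' h rfl
        obtain rfl : d = d' := by simpa using h2
        exact Or.inr (by simpa [yieldList, Nat.add_assoc] using h')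

theorem mem_skeletonLeaves_add (F : FactForest A) : ∀ o d i,
    i ∈ skeletonLeaves (o + d) F ↔ ∃ j ∈ skeletonLeaves d F, i = o + j := by
  refine induction_on_children F ?_ ?_
  · intro a o d i
    simp [skeletonLeaves]
  · intro cs ih o d i
    simp only [mem_skeletonLeaves_node]
    constructor
    · rintro ⟨l, c, r, rfl, h, hi⟩
      rw [Nat.add_assoc, ih c (by simp)] at hi
      obtain ⟨j, hj, rfl⟩ := hi
      exact ⟨j, ⟨l, c, r, rfl, h, hj⟩, rfl⟩
    · rintro ⟨j, ⟨l, c, r, rfl, h, hj⟩, rfl⟩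
      refine ⟨l, c, r, rfl, h, ?_⟩
      rw [Nat.add_assoc, ih c (by simp)]
      exact ⟨j, hj, rfl⟩

theorem mem_frontier_nil {F : FactForest A} {i : ℕ} :
    i ∈ F.frontier [] ↔ i ∈ skeletonLeaves 0 F := by
  cases F <;> simp [frontier, subtree, offset]

theorem mem_frontier_node_nil {cs : List (FactForest A)} {i : ℕ} :
    i ∈ (node cs).frontier [] ↔ ∃ l c r, cs = l ++ c :: r ∧ (l = [] ∨ r = []) ∧
      ∃ j ∈ c.frontier [], i = (yieldList l).length + j := by
  rw [mem_frontier_nil, mem_skeletonLeaves_node]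
  simp only [Nat.zero_add]
  refine exists_congr fun l => exists_congr fun c => exists_congr fun r => ?_
  rw [← Nat.add_zero (yieldList l).length, mem_skeletonLeaves_add]
  simp only [mem_frontier_nil, Nat.add_zero]

theorem mem_frontier_node_cons {l r : List (FactForest A)} {c : FactForest A} {p : List ℕ} {i : ℕ} :
    i ∈ (node (l ++ c :: r)).frontier (l.length :: p) ↔
      ∃ j ∈ c.frontier p, i = (yieldList l).length + j := by
  simp only [frontier, subtree, offset]
  simp only [List.getElem?_append_right le_rfl, Nat.sub_self, List.getElem?_cons_zero,
    List.take_left]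
  split
  · rw [mem_skeletonLeaves_add]
  · simp

/-- The frontiers of the iterable nodes and of the root form a partition of the positions. -/
theorem mem_frontier_iff (F : FactForest A) : ∀ i t,
    i ∈ F.frontier t ∧ t ∈ insert [] F.iter ↔ i < F.yield.length ∧ t = F.owner i := by
  refine induction_on_children F ?_ ?_
  · intro a i t
    simp only [iter, yield, owner]
    constructor
    · rintro ⟨h1, h2⟩
      obtain rfl : t = [] := by simpa using h2
      rw [mem_frontier_nil] at h1
      simpa [skeletonLeaves] using h1
    · rintro ⟨h1, rfl⟩
      rw [mem_frontier_nil]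
      simpa [skeletonLeaves] using h1
  · intro cs ih i t
    constructor
    · rintro ⟨h1, h2⟩
      rw [Finset.mem_insert] at h2
      -- Three cases: the root, whose frontier comes from its extremal children; an inner child
      -- itself; an iterable node inside a child.
      rcases h2 with rfl | h2
      · rw [mem_frontier_node_nil] at h1
        obtain ⟨l, c, r, rfl, hlr, j, hj, rfl⟩ := h1
        obtain ⟨h3, h4⟩ := (ih c (by simp) j []).1 ⟨hj, by simp⟩
        refine ⟨by simp [yield, yieldList]; omega, ?_⟩
        rw [owner_node _ _ _ _ h3, if_pos ⟨h4.symm, hlr⟩]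
      · rw [mem_iter_node] at h2
        obtain ⟨l, c, r, rfl, ⟨rfl, hl, hr⟩ | ⟨p, hp, rfl⟩⟩ := h2
        · rw [mem_frontier_node_cons] at h1
          obtain ⟨j, hj, rfl⟩ := h1
          obtain ⟨h3, h4⟩ := (ih c (by simp) j []).1 ⟨hj, by simp⟩
          refine ⟨by simp [yield, yieldList]; omega, ?_⟩
          rw [owner_node _ _ _ _ h3, if_neg (by simp [hl, hr]), h4]
        · rw [mem_frontier_node_cons] at h1
          obtain ⟨j, hj, rfl⟩ := h1
          obtain ⟨h3, h4⟩ := (ih c (by simp) j p).1 ⟨hj, by simp [hp]⟩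
          refine ⟨by simp [yield, yieldList]; omega, ?_⟩
          rw [owner_node _ _ _ _ h3, if_neg, h4]
          rintro ⟨h5, -⟩
          rw [h4, h5] at hp
          exact nil_notMem_iter c hp
    · rintro ⟨h1, rfl⟩
      rw [yield] at h1
      obtain ⟨l, c, r, j, rfl, rfl, hj⟩ := exists_eq_append_cons h1
      obtain ⟨h3, h4⟩ := (ih c (by simp) j _).2 ⟨hj, rfl⟩
      rw [owner_node _ _ _ _ hj]
      split_ifs with h
      · refine ⟨mem_frontier_node_nil.2 ⟨l, c, r, rfl, h.2, j, ?_, rfl⟩, by simp⟩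
        rw [← h.1]
        exact h3
      · refine ⟨mem_frontier_node_cons.2 ⟨j, h3, rfl⟩, ?_⟩
        rw [Finset.mem_insert, mem_iter_node] at *
        refine Or.inr ⟨l, c, r, rfl, ?_⟩
        rcases h4 with h4 | h4
        · simp only [h4, true_and, not_or] at h
          exact Or.inl ⟨by rw [h4], h⟩
        · exact Or.inr ⟨_, h4, rfl⟩

-- Bounds on owners and frontiers in terms of the height

theorem length_owner_le (F : FactForest A) : ∀ i, i < F.yield.length →
    (F.owner i).length ≤ F.height := by
  refine induction_on_children F ?_ ?_
  · simp [owner]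
  · intro cs ih i hi
    rw [yield] at hi
    obtain ⟨l, c, r, j, rfl, rfl, hj⟩ := exists_eq_append_cons hi
    rw [owner_node _ _ _ _ hj, height]
    have h1 := ih c (by simp) j hj
    have h2 := heightList_le.1 (le_refl (heightList (l ++ c :: r))) c (by simp)
    split_ifs
    · simp
    · simp only [List.length_cons]; omega

/-- A skeleton branches at most twice at each node. -/
theorem card_skeletonLeaves_le (F : FactForest A) : ∀ o, (skeletonLeaves o F).card ≤ 2 ^ F.height := by
  refine induction_on_children F ?_ ?_
  · simp [skeletonLeaves, height]
  · intro cs ih o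
    rcases cs with _ | ⟨c, cs⟩
    · simp [skeletonLeaves]
    have h2 := heightList_le.1 (le_refl (heightList (c :: cs)))
    have h3 : ∀ d ∈ c :: cs, 2 ^ d.height ≤ 2 ^ (heightList (c :: cs) - 1) := fun d hd =>
      Nat.pow_le_pow_right (by norm_num) (by have := h2 d hd; omega)
    have h4 : 1 ≤ heightList (c :: cs) := by have := h2 c (by simp); omega
    have h5 : (skeletonLeavesLast (o + c.yield.length) cs).card ≤
        2 ^ (heightList (c :: cs) - 1) := by
      rcases List.eq_nil_or_concat cs with rfl | ⟨l, d, rfl⟩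
      · simp [skeletonLeavesLast]
      · rw [List.concat_eq_append] at h3 ⊢
        rw [skeletonLeavesLast_concat]
        exact (ih d (by simp) _).trans (h3 d (by simp))
    calc _ ≤ _ := by rw [skeletonLeaves]; exact Finset.card_union_le _ _
      _ ≤ 2 ^ (heightList (c :: cs) - 1) + 2 ^ (heightList (c :: cs) - 1) :=
        add_le_add ((ih c (by simp) _).trans (h3 c (by simp))) h5
      _ = 2 ^ (node (c :: cs)).height := by
        rw [height, ← two_mul, ← pow_succ', Nat.sub_add_cancel h4]

theorem height_subtree_le {F G : FactForest A} {t : List ℕ} (h : F.subtree t = some G) :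
    G.height ≤ F.height := by
  induction t generalizing F with
  | nil => simp only [subtree, Option.some.injEq] at h; rw [h]
  | cons i t ih =>
    rcases F with a | cs
    · simp [subtree] at h
    · simp only [subtree] at h
      split at h
      · next c hc =>
        have h2 := heightList_le.1 (le_refl (heightList cs)) c (List.mem_of_getElem? hc)
        have := ih h
        rw [height]
        omega
      · cases h

theorem card_frontier_le (F : FactForest A) (t : List ℕ) : (F.frontier t).card ≤ 2 ^ F.height := by
  unfold frontier
  split
  · next G hG =>
    exact (card_skeletonLeaves_le _ _).trans
      (Nat.pow_le_pow_right (by norm_num) (height_subtree_le hG))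
  · simp

/-! ## The dependence relation between positions -/

theorem ancestorOrSibling_refl (t : List ℕ) : AncestorOrSibling t t :=
  Or.inl (List.prefix_refl t)

theorem ancestorOrSibling_nil_left (t : List ℕ) : AncestorOrSibling [] t :=
  Or.inl List.nil_prefix

theorem ancestorOrSibling_nil_right {s : List ℕ} : AncestorOrSibling s [] ↔ s = [] := by
  simp [AncestorOrSibling]

theorem ancestorOrSibling_cons_cons_self {a : ℕ} {s t : List ℕ} :
    AncestorOrSibling (a :: s) (a :: t) ↔ AncestorOrSibling s t := by
  constructor
  · rintro (h | ⟨q, i, ⟨h, h'⟩ | ⟨h, h'⟩⟩)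
    · exact Or.inl (List.cons_prefix_cons.1 h).2
    all_goals
      rcases q with _ | ⟨b, q⟩
      -- Here the siblings are the nodes `a` and its neighbour; then `s` is the root of the subtree,
      -- an ancestor of everything in it.
      · obtain rfl : s = [] := by simp at h; exact h.2
        exact ancestorOrSibling_nil_left t
      · simp only [List.cons_append, List.cons.injEq, List.cons_prefix_cons] at h h'
        first
          | exact Or.inr ⟨q, i, Or.inl ⟨h.2, h'.2⟩⟩
          | exact Or.inr ⟨q, i, Or.inr ⟨h.2, h'.2⟩⟩
  · rintro (h | ⟨q, i, ⟨rfl, h'⟩ | ⟨rfl, h'⟩⟩)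
    · exact Or.inl (List.cons_prefix_cons.2 ⟨rfl, h⟩)
    · exact Or.inr ⟨a :: q, i, Or.inl ⟨rfl, List.cons_prefix_cons.2 ⟨rfl, h'⟩⟩⟩
    · exact Or.inr ⟨a :: q, i, Or.inr ⟨rfl, List.cons_prefix_cons.2 ⟨rfl, h'⟩⟩⟩

theorem ancestorOrSibling_cons_cons_of_ne {a b : ℕ} {s t : List ℕ} (hab : a ≠ b) :
    AncestorOrSibling (a :: s) (b :: t) ↔ s = [] ∧ (b = a + 1 ∨ a = b + 1) := by
  constructor
  · rintro (h | ⟨q, i, ⟨h, h'⟩ | ⟨h, h'⟩⟩)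
    · exact absurd (List.cons_prefix_cons.1 h).1 hab
    all_goals
      rcases q with _ | ⟨c, q⟩
      · simp at h h'
        refine ⟨h.2, ?_⟩
        omega
      · simp only [List.cons_append, List.cons.injEq, List.cons_prefix_cons] at h h'
        exact absurd (h.1.trans h'.1) hab
  · rintro ⟨rfl, rfl | rfl⟩
    · exact Or.inr ⟨[], a, Or.inl ⟨rfl, by simp⟩⟩
    · exact Or.inr ⟨[], b, Or.inr ⟨rfl, by simp⟩⟩

/-- Two positions are linked if an independent set cannot contain the owners of both. -/
def Linked (F : FactForest A) (i j : ℕ) : Prop :=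
  AncestorOrSibling (F.owner i) (F.owner j) ∨ AncestorOrSibling (F.owner j) (F.owner i)

theorem linked_comm {F : FactForest A} {i j : ℕ} : F.Linked i j ↔ F.Linked j i := or_comm

theorem linked_of_owner_eq_nil {F : FactForest A} {i : ℕ} (h : F.owner i = []) (j : ℕ) :
    F.Linked i j := by
  rw [Linked, h]
  exact Or.inl (ancestorOrSibling_nil_left _)

theorem linked_node_same {l r : List (FactForest A)} {c : FactForest A} {i j : ℕ}
    (hi : i < c.yield.length) (hj : j < c.yield.length) :
    (node (l ++ c :: r)).Linked ((yieldList l).length + i) ((yieldList l).length + j) ↔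
      c.Linked i j := by
  simp only [Linked, owner_node _ _ _ _ hi, owner_node _ _ _ _ hj]
  split_ifs with h1 h2 h2
  · simp [h1.1, ancestorOrSibling_nil_left]
  · simp [h1.1, ancestorOrSibling_nil_left]
  · simp [h2.1, ancestorOrSibling_nil_left]
  · simp only [ancestorOrSibling_cons_cons_self]

/-- Paths into different children differ in their first index. So either one owner is the root,
possible only through an extremal child, or one owner is a child adjacent to the child containing
the other position. -/
theorem linked_node_of_ne {l m r : List (FactForest A)} {c d : FactForest A} {i j : ℕ}
    (hi : i < c.yield.length) (hj : j < d.yield.length) :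
    (node (l ++ c :: (m ++ d :: r))).Linked ((yieldList l).length + i)
        ((yieldList (l ++ c :: m)).length + j) ↔
      (owner c i = [] ∧ l = []) ∨ (owner d j = [] ∧ r = []) ∨
        (m = [] ∧ (owner c i = [] ∨ owner d j = [])) := by
  have h1 := owner_node l (m ++ d :: r) c i hi
  have h2 := owner_node (l ++ c :: m) r d j hj
  rw [List.append_assoc, List.cons_append] at h2
  simp only [Linked, h1, h2]
  have h3 : m ++ d :: r ≠ [] := by simp
  have h4 : l ++ c :: m ≠ [] := by simp
  simp only [h3, h4, or_false, false_or]
  have hne : l.length ≠ (l ++ c :: m).length := by simp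
  have hm : (l ++ c :: m).length = l.length + 1 ↔ m = [] := by
    rw [← List.length_eq_zero_iff]; simp
  have hm' : l.length ≠ (l ++ c :: m).length + 1 := by simp; omega
  split_ifs with h5 h6 h6
  · simp [h5, ancestorOrSibling_nil_left]
  · simp [h5, ancestorOrSibling_nil_left]
  · simp [h6, ancestorOrSibling_nil_left]
  · rw [ancestorOrSibling_cons_cons_of_ne hne, ancestorOrSibling_cons_cons_of_ne hne.symm]
    simp only [hm, hm', or_false, false_or]
    tauto

end FactForest

namespace FactForest

/-! ## Regularity of properness -/

section Proper

variable {A : Type u} {M : Type v} [Monoid M]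

theorem isProper_node_iff (μ : FreeMonoid A →* M) (cs : List (FactForest A)) :
    IsProper μ (node cs) ↔ 1 ≤ cs.length ∧ (∀ c ∈ cs, IsProper μ c) ∧
      (3 ≤ cs.length → ∃ e : M, IsIdempotentElem e ∧
        ∀ c ∈ cs, μ (FreeMonoid.ofList c.yield) = e) := by
  rw [Nat.one_le_iff_ne_zero, Ne, List.length_eq_zero_iff]
  constructor
  · rintro ⟨⟩
    exact ⟨‹_›, ‹_›, ‹_›⟩
  · rintro ⟨h1, h2, h3⟩
    exact IsProper.node cs h1 h2 h3

/-- An instance of `isRegularFun_of_fold`: the value of a tree is its properness together with its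
image in `M`. -/
theorem isRegularFun_isProper [Finite M] (μ : FreeMonoid A →* M) (K : ℕ) :
    IsRegularFun fun x => ∃ F : FactForest A, encode F = x ∧ F.height ≤ K ∧ IsProper μ F := by
  let φ : FactForest A → Prop × M := fun F => (IsProper μ F, μ (FreeMonoid.ofList F.yield))
  -- The number of children matters only up to three; the intermediate thresholds serve to update
  -- the last one. The predicate on `M` records which `e` is the common value so far.
  let r : List (FactForest A) → (Prop × Prop × Prop) × (M → Prop) × Prop × M := fun cs =>
    ((1 ≤ cs.length, 2 ≤ cs.length, 3 ≤ cs.length),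
      fun e => ∀ c ∈ cs, μ (FreeMonoid.ofList c.yield) = e,
      ∀ c ∈ cs, IsProper μ c, μ (FreeMonoid.ofList (yieldList cs)))
  obtain ⟨G, hG, hG'⟩ := isRegularFun_of_fold φ r
    (fun q s => ((True, q.1.1, q.1.2.1), fun e => q.2.1 e ∧ s.2 = e, q.2.2.1 ∧ s.1, q.2.2.2 * s.2))
    (by
      intro cs c
      simp only [r, φ, Prod.mk.injEq, List.length_append, List.length_singleton, eq_iff_iff,
        List.mem_append, List.mem_singleton, or_imp, forall_and, forall_eq, yieldList_append,
        FreeMonoid.ofList_append, map_mul, yieldList, List.append_nil, and_true]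
      refine ⟨by simp, ?_, ?_⟩ <;> omega)
    (fun q => (q.1.1 ∧ q.2.2.1 ∧ (q.1.2.2 → ∃ e, IsIdempotentElem e ∧ q.2.1 e), q.2.2.2))
    (by
      intro cs
      simp only [r, φ, isProper_node_iff, yield])
    K
  have h := hG.comp fun o => ∃ m, o = some (True, m)
  convert h using 3 with x
  simp only [hG', φ, Prod.mk.injEq, eq_iff_iff, iff_true]
  constructor
  · rintro ⟨F, h1, h2, h3⟩
    exact ⟨_, F, h1, h2, h3, rfl⟩
  · rintro ⟨_, F, h1, h2, h3, -⟩
    exact ⟨F, h1, h2, h3⟩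

end Proper

/-! ## Regularity of links between labelled positions -/

section Linked

variable {L : Type u}

/-- The leaf in position `i` has a label with the property `P`. -/
def HasLabel (P : L → Prop) (F : FactForest L) (i : ℕ) : Prop :=
  ∃ b, F.yield[i]? = some b ∧ P b

theorem HasLabel.lt {P : L → Prop} {F : FactForest L} {i : ℕ} (h : F.HasLabel P i) :
    i < F.yield.length := by
  obtain ⟨b, hb, -⟩ := h
  exact (List.getElem?_eq_some_iff.1 hb).1

theorem hasLabel_node_append {P : L → Prop} {l r : List (FactForest L)} {c : FactForest L} {i : ℕ}
    (hi : i < c.yield.length) :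
    (node (l ++ c :: r)).HasLabel P ((yieldList l).length + i) ↔ c.HasLabel P i := by
  have : (node (l ++ c :: r)).yield[(yieldList l).length + i]? = c.yield[i]? := by
    simp only [yield, yieldList_append, yieldList]
    rw [List.getElem?_append_right (by omega), Nat.add_sub_cancel_left,
      List.getElem?_append_left hi]
  simp only [HasLabel, this]

theorem hasLabel_node {P : L → Prop} {cs : List (FactForest L)} {n : ℕ} :
    (node cs).HasLabel P n ↔ ∃ l c r i, cs = l ++ c :: r ∧ n = (yieldList l).length + i ∧
      c.HasLabel P i := by
  constructor
  · intro h
    have hn := h.lt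
    rw [yield] at hn
    obtain ⟨l, c, r, i, rfl, rfl, hi⟩ := exists_eq_append_cons hn
    exact ⟨l, c, r, i, rfl, rfl, (hasLabel_node_append hi).1 h⟩
  · rintro ⟨l, c, r, i, rfl, rfl, h⟩
    exact (hasLabel_node_append h.lt).2 h

/-- Some leaf has the property `P`. -/
def Occurs (P : L → Prop) (F : FactForest L) : Prop := ∃ i, F.HasLabel P i

/-- Some leaf of the skeleton of the root has the property `P`. -/
def OccursAtRoot (P : L → Prop) (F : FactForest L) : Prop :=
  ∃ i, F.HasLabel P i ∧ F.owner i = []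

/-- Some leaf with the property `P` is linked to some leaf with the property `Q`. -/
def OccursLinked (P Q : L → Prop) (F : FactForest L) : Prop :=
  ∃ i j, F.HasLabel P i ∧ F.HasLabel Q j ∧ F.Linked i j

/-- The leaves of two adjacent siblings that are linked in the parent. -/
def AdjacentLinked (P Q : L → Prop) (c d : FactForest L) : Prop :=
  c.OccursAtRoot P ∧ d.Occurs Q ∨ c.Occurs P ∧ d.OccursAtRoot Q ∨
    c.OccursAtRoot Q ∧ d.Occurs P ∨ c.Occurs Q ∧ d.OccursAtRoot P

theorem occurs_node {P : L → Prop} {cs : List (FactForest L)} :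
    (node cs).Occurs P ↔ ∃ c ∈ cs, c.Occurs P := by
  simp only [Occurs, hasLabel_node]
  constructor
  · rintro ⟨_, l, c, r, i, rfl, rfl, h⟩
    exact ⟨c, by simp, i, h⟩
  · rintro ⟨c, hc, i, h⟩
    obtain ⟨l, r, rfl⟩ := List.append_of_mem hc
    exact ⟨_, l, c, r, i, rfl, rfl, h⟩

theorem occursAtRoot_node {P : L → Prop} {cs : List (FactForest L)} :
    (node cs).OccursAtRoot P ↔
      (∃ c ∈ cs.head?, c.OccursAtRoot P) ∨ ∃ c ∈ cs.getLast?, c.OccursAtRoot P := by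
  have h1 : (node cs).OccursAtRoot P ↔ ∃ l c r, cs = l ++ c :: r ∧ (l = [] ∨ r = []) ∧
      c.OccursAtRoot P := by
    simp only [OccursAtRoot, hasLabel_node]
    constructor
    · rintro ⟨_, ⟨l, c, r, i, rfl, rfl, h⟩, h'⟩
      rw [owner_node _ _ _ _ h.lt] at h'
      split_ifs at h' with h2
      exact ⟨l, c, r, rfl, h2.2, i, h, h2.1⟩
    · rintro ⟨l, c, r, rfl, h2, i, h, h3⟩
      refine ⟨_, ⟨l, c, r, i, rfl, rfl, h⟩, ?_⟩
      rw [owner_node _ _ _ _ h.lt, if_pos ⟨h3, h2⟩]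
  rw [h1]
  constructor
  · rintro ⟨l, c, r, rfl, rfl | rfl, h⟩
    · exact Or.inl ⟨c, by simp, h⟩
    · exact Or.inr ⟨c, by simp, h⟩
  · rintro (⟨c, hc, h⟩ | ⟨c, hc, h⟩)
    · obtain ⟨r, rfl⟩ : ∃ r, cs = c :: r := by
        cases cs with
        | nil => simp at hc
        | cons d r => simp at hc; exact ⟨r, by rw [hc]⟩
      exact ⟨[], c, r, rfl, Or.inl rfl, h⟩
    · obtain ⟨l, rfl⟩ := List.getLast?_eq_some_iff.1 hc
      exact ⟨l, c, [], rfl, Or.inr rfl, h⟩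

/-- Some adjacent members of a list are in a relation. -/
def ExistsAdjacent {X : Type*} (R : X → X → Prop) (cs : List X) : Prop :=
  ∃ l c d r, cs = l ++ c :: d :: r ∧ R c d

theorem existsAdjacent_concat {X : Type*} {R : X → X → Prop} {cs : List X} {e : X} :
    ExistsAdjacent R (cs ++ [e]) ↔ ExistsAdjacent R cs ∨ ∃ c ∈ cs.getLast?, R c e := by
  constructor
  · rintro ⟨l, c, d, r, h, hR⟩
    rcases List.eq_nil_or_concat r with rfl | ⟨r, f, rfl⟩
    · rw [show l ++ [c, d] = (l ++ [c]) ++ [d] by simp] at h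
      obtain ⟨rfl, h2⟩ := List.append_inj' h rfl
      obtain rfl : e = d := by simpa using h2
      exact Or.inr ⟨c, by simp, hR⟩
    · rw [show l ++ c :: d :: r.concat f = (l ++ c :: d :: r) ++ [f] by simp] at h
      obtain ⟨rfl, -⟩ := List.append_inj' h rfl
      exact Or.inl ⟨l, c, d, r, rfl, hR⟩
  · rintro (⟨l, c, d, r, rfl, hR⟩ | ⟨c, hc, hR⟩)
    · exact ⟨l, c, d, r ++ [e], by simp, hR⟩
    · obtain ⟨l, rfl⟩ := List.getLast?_eq_some_iff.1 hc
      exact ⟨l, c, e, [], by simp, hR⟩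

theorem append_cons_eq_append_cons {X : Type*} {l r l' r' : List X} {c d : X}
    (h : l ++ c :: r = l' ++ d :: r') :
    (l = l' ∧ c = d ∧ r = r') ∨ (∃ m, l' = l ++ c :: m ∧ r = m ++ d :: r') ∨
      ∃ m, l = l' ++ d :: m ∧ r' = m ++ c :: r := by
  induction l generalizing l' with
  | nil =>
    cases l' with
    | nil => left; simpa using h
    | cons x l' =>
      right; left
      simp only [List.nil_append, List.cons_append, List.cons.injEq] at h
      exact ⟨l', by simp [h.1], h.2⟩
  | cons y l ih =>
    cases l' with
    | nil =>
      right; right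
      simp only [List.nil_append, List.cons_append, List.cons.injEq] at h
      exact ⟨l, by simp [h.1], h.2.symm⟩
    | cons x l' =>
      simp only [List.cons_append, List.cons.injEq] at h
      obtain ⟨rfl, h⟩ := h
      rcases ih h with ⟨rfl, rfl, rfl⟩ | ⟨m, rfl, rfl⟩ | ⟨m, rfl, rfl⟩
      · simp
      · exact Or.inr (Or.inl ⟨m, by simp, rfl⟩)
      · exact Or.inr (Or.inr ⟨m, by simp, rfl⟩)

/-- Links inside a child persist in the parent, and a leaf in the skeleton of the root is linked to
every leaf. By `linked_node_of_ne`, all other links join adjacent children. -/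
theorem occursLinked_node {P Q : L → Prop} {cs : List (FactForest L)} :
    (node cs).OccursLinked P Q ↔ (∃ c ∈ cs, c.OccursLinked P Q) ∨
      ((node cs).OccursAtRoot P ∧ (node cs).Occurs Q) ∨
      ((node cs).Occurs P ∧ (node cs).OccursAtRoot Q) ∨
      ExistsAdjacent (AdjacentLinked P Q) cs := by
  constructor
  · rintro ⟨_, _, hi', hj', h⟩
    obtain ⟨l, c, r, i, rfl, rfl, hi⟩ := hasLabel_node.1 hi'
    obtain ⟨l', d, r', j, h', rfl, hj⟩ := hasLabel_node.1 hj'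
    rcases append_cons_eq_append_cons h' with ⟨rfl, rfl, rfl⟩ | ⟨m, rfl, rfl⟩ | ⟨m, rfl, rfl⟩
    · rw [linked_node_same hi.lt hj.lt] at h
      exact Or.inl ⟨c, by simp, i, j, hi, hj, h⟩
    · rw [linked_node_of_ne hi.lt hj.lt] at h
      rcases h with ⟨h, rfl⟩ | ⟨h, rfl⟩ | ⟨rfl, h | h⟩
      · exact Or.inr (Or.inl ⟨occursAtRoot_node.2 (Or.inl ⟨c, by simp, i, hi, h⟩), _, hj'⟩)
      · exact Or.inr (Or.inr (Or.inl ⟨⟨_, hi'⟩, occursAtRoot_node.2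
          (Or.inr ⟨d, List.getLast?_eq_some_iff.2 ⟨l ++ c :: m, by simp⟩, j, hj, h⟩)⟩))
      · exact Or.inr (Or.inr (Or.inr ⟨l, c, d, r', rfl, Or.inl ⟨⟨i, hi, h⟩, j, hj⟩⟩))
      · exact Or.inr (Or.inr (Or.inr ⟨l, c, d, r', rfl, Or.inr (Or.inl ⟨⟨i, hi⟩, j, hj, h⟩)⟩))
    · rw [linked_comm, show l' ++ d :: m ++ c :: r = l' ++ d :: (m ++ c :: r) by simp,
        linked_node_of_ne hj.lt hi.lt] at h
      rcases h with ⟨h, rfl⟩ | ⟨h, rfl⟩ | ⟨rfl, h | h⟩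
      · exact Or.inr (Or.inr (Or.inl ⟨⟨_, hi'⟩, occursAtRoot_node.2
          (Or.inl ⟨d, by simp, j, hj, h⟩)⟩))
      · exact Or.inr (Or.inl ⟨occursAtRoot_node.2
          (Or.inr ⟨c, List.getLast?_eq_some_iff.2 ⟨l' ++ d :: m, by simp⟩, i, hi, h⟩), _, hj'⟩)
      · exact Or.inr (Or.inr (Or.inr ⟨l', d, c, r, by simp,
          Or.inr (Or.inr (Or.inl ⟨⟨j, hj, h⟩, i, hi⟩))⟩))
      · exact Or.inr (Or.inr (Or.inr ⟨l', d, c, r, by simp,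
          Or.inr (Or.inr (Or.inr ⟨⟨j, hj⟩, i, hi, h⟩))⟩))
  · rintro (⟨c, hc, i, j, hi, hj, h⟩ | ⟨⟨i, hi, h⟩, j, hj⟩ | ⟨⟨i, hi⟩, j, hj, h⟩ |
      ⟨l, c, d, r, rfl, h⟩)
    · obtain ⟨l, r, rfl⟩ := List.append_of_mem hc
      exact ⟨_, _, (hasLabel_node_append hi.lt).2 hi, (hasLabel_node_append hj.lt).2 hj,
        (linked_node_same hi.lt hj.lt).2 h⟩
    · exact ⟨i, j, hi, hj, linked_of_owner_eq_nil h j⟩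
    · exact ⟨i, j, hi, hj, linked_comm.1 (linked_of_owner_eq_nil h i)⟩
    -- Stated for all `P` and `Q`, since the leaf with `P` may lie in either of the two adjacent
    -- children.
    · have key : ∀ {P Q : L → Prop} {i j}, c.HasLabel P i → d.HasLabel Q j →
          (c.owner i = [] ∨ d.owner j = []) → ∃ i j, (node (l ++ c :: d :: r)).HasLabel P i ∧
            (node (l ++ c :: d :: r)).HasLabel Q j ∧ (node (l ++ c :: d :: r)).Linked i j := by
        intro P Q i j hi hj h
        refine ⟨_, _, (hasLabel_node_append hi.lt).2 hi, ?_,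
          (linked_node_of_ne (m := []) hi.lt hj.lt).2 (Or.inr (Or.inr ⟨rfl, h⟩))⟩
        have := (hasLabel_node_append (l := l ++ [c]) (r := r) hj.lt).2 hj
        simpa using this
      have key' : ∀ {i j}, c.HasLabel Q i → d.HasLabel P j →
          (c.owner i = [] ∨ d.owner j = []) → (node (l ++ c :: d :: r)).OccursLinked P Q := by
        intro i j hi hj h
        obtain ⟨i', j', h1, h2, h3⟩ := key hi hj h
        exact ⟨j', i', h2, h1, linked_comm.1 h3⟩
      rcases h with ⟨⟨i, hi, h⟩, j, hj⟩ | ⟨⟨i, hi⟩, j, hj, h⟩ | ⟨⟨i, hi, h⟩, j, hj⟩ |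
        ⟨⟨i, hi⟩, j, hj, h⟩
      · exact key hi hj (Or.inl h)
      · exact key hi hj (Or.inr h)
      · exact key' hi hj (Or.inl h)
      · exact key' hi hj (Or.inr h)

/-- The occurrences of labels with the properties `P` and `Q` in a tree, as needed by its parent. -/
structure Occurrences where
  left : Prop
  right : Prop
  rootLeft : Prop
  rootRight : Prop
  linked : Prop

instance : Finite Occurrences :=
  Finite.of_injective (fun t => (t.left, t.right, t.rootLeft, t.rootRight, t.linked)) (by
    rintro ⟨⟩ ⟨⟩ h
    simpa using h)

/-- The occurrences of labels with the properties `P` and `Q` in a tree. -/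
def occurrences (P Q : L → Prop) (F : FactForest L) : Occurrences where
  left := F.Occurs P
  right := F.Occurs Q
  rootLeft := F.OccursAtRoot P
  rootRight := F.OccursAtRoot Q
  linked := F.OccursLinked P Q

/-- `AdjacentLinked` in terms of the occurrences. -/
def Occurrences.Adjacent (s t : Occurrences) : Prop :=
  s.rootLeft ∧ t.right ∨ s.left ∧ t.rootRight ∨ s.rootRight ∧ t.left ∨ s.right ∧ t.rootLeft

/-- The state of the automaton that reads the occurrences in the children of a node. -/
structure ChildrenState where
  first : Option Occurrences
  last : Option Occurrences
  left : Prop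
  right : Prop
  linked : Prop

instance : Finite ChildrenState :=
  Finite.of_injective (fun t => (t.first, t.last, t.left, t.right, t.linked)) (by
    rintro ⟨⟩ ⟨⟩ h
    simpa using h)

/-- The state after reading a list of children. -/
def childrenState (P Q : L → Prop) (cs : List (FactForest L)) : ChildrenState where
  first := cs.head?.map (occurrences P Q)
  last := cs.getLast?.map (occurrences P Q)
  left := ∃ c ∈ cs, c.Occurs P
  right := ∃ c ∈ cs, c.Occurs Q
  linked := (∃ c ∈ cs, c.OccursLinked P Q) ∨ ExistsAdjacent (AdjacentLinked P Q) cs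

/-- The equations for nodes use only the first child, the last child, disjunctions over all children
and a condition on adjacent children; remembering the last child read suffices to update the latter.
-/
theorem isRegularFun_occurrences (P Q : L → Prop) (K : ℕ) :
    ∃ G : List (Bracketed L) → Option Occurrences, IsRegularFun G ∧
      ∀ x s, G x = some s ↔ ∃ F : FactForest L, encode F = x ∧ F.height ≤ K ∧
        occurrences P Q F = s := by
  refine isRegularFun_of_fold (occurrences P Q) (childrenState P Q)
    (fun q s =>
      { first := some (q.first.getD s)
        last := some s
        left := q.left ∨ s.left
        right := q.right ∨ s.right
        linked := q.linked ∨ s.linked ∨ ∃ t ∈ q.last, t.Adjacent s })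
    ?_
    (fun q =>
      let rl := (∃ t ∈ q.first, t.rootLeft) ∨ ∃ t ∈ q.last, t.rootLeft
      let rr := (∃ t ∈ q.first, t.rootRight) ∨ ∃ t ∈ q.last, t.rootRight
      { left := q.left
        right := q.right
        rootLeft := rl
        rootRight := rr
        linked := q.linked ∨ (rl ∧ q.right) ∨ (q.left ∧ rr) })
    ?_ K
  · intro cs c
    simp only [childrenState, ChildrenState.mk.injEq]
    refine ⟨?_, by simp, ?_, ?_, ?_⟩
    · cases cs <;> simp
    · simp [or_and_right, exists_or, occurrences]
    · simp [or_and_right, exists_or, occurrences]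
    · rw [existsAdjacent_concat]
      have : (∃ c' ∈ cs.getLast?, AdjacentLinked P Q c' c) ↔
          ∃ t ∈ cs.getLast?.map (occurrences P Q), t.Adjacent (occurrences P Q c) := by
        simp [occurrences, AdjacentLinked, Occurrences.Adjacent]
      rw [this]
      simp only [List.mem_append, List.mem_singleton, or_and_right, exists_or, exists_eq_left,
        occurrences, eq_iff_iff]
      simp only [or_assoc, or_left_comm, or_comm]
  · intro cs
    simp only [childrenState, occurrences, Occurrences.mk.injEq, occursLinked_node, occurs_node,
      occursAtRoot_node, eq_iff_iff, true_and, Option.mem_def, Option.map_eq_some_iff,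
      exists_exists_and_eq_and]
    simp only [or_assoc, or_left_comm, or_comm]

end Linked

end FactForest

/-! ## Counting tuples -/

theorem card_tuples (n k : ℕ) : (tuples n k).card = n ^ k := by
  induction k with
  | zero => simp [tuples]
  | succ k ih =>
    rw [Finset.card_eq_sum_ones, sum_tuples_succ]
    simp [ih, pow_succ']

section Counting

-- Union bound: `k` places for the special entry, `d` values for it, and `n` for each of the others.
open Classical in
theorem card_tuples_filter_exists_le (n d k : ℕ) (p : ℕ → Prop)
    (hp : ((Finset.range n).filter p).card ≤ d) :
    ((tuples n k).filter fun v => ∃ j ∈ v, p j).card ≤ k * d * n ^ (k - 1) := by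
  induction k with
  | zero => simp [tuples]
  | succ k ih =>
    rw [Finset.card_filter, sum_tuples_succ]
    calc _ ≤ ∑ i ∈ Finset.range n, ∑ v ∈ tuples n k,
          ((if p i then 1 else 0) + if ∃ j ∈ v, p j then 1 else 0) := by
          refine Finset.sum_le_sum fun i _ => Finset.sum_le_sum fun v _ => ?_
          by_cases h1 : p i <;> by_cases h2 : ∃ j ∈ v, p j <;> simp [h1, h2]
      _ = n ^ k * ((Finset.range n).filter p).card +
          n * ((tuples n k).filter fun v => ∃ j ∈ v, p j).card := by
          simp only [Finset.sum_add_distrib, Finset.sum_const, card_tuples, smul_eq_mul,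
            Finset.card_range, ← Finset.mul_sum, ← Finset.card_filter]
      _ ≤ n ^ k * d + n * (k * d * n ^ (k - 1)) := by gcongr
      _ ≤ (k + 1) * d * n ^ k := by
          cases k with
          | zero => simp
          | succ k => rw [Nat.add_sub_cancel, pow_succ]; apply le_of_eq; ring

-- Only the number of left partners `j` of a given `t` is bounded, as `a` need not be symmetric.
-- When `a i j` holds for the head `i` and some `j` in the tail, the tail is chosen first; when `a j
-- i` holds, the head is chosen first.
open Classical in
theorem card_tuples_filter_not_pairwise_le (n d k : ℕ) (a : ℕ → ℕ → Prop)
    (ha : ∀ t < n, ((Finset.range n).filter fun j => a j t).card ≤ d) :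
    ((tuples n k).filter fun v => ¬ v.Pairwise fun i j => ¬ (a i j ∨ a j i)).card ≤
      d * k ^ 2 * n ^ (k - 1) := by
  induction k with
  | zero => simp [tuples]
  | succ k ih =>
    rw [Finset.card_filter, sum_tuples_succ]
    have h1 : ∀ v ∈ tuples n k,
        ((Finset.range n).filter fun i => ∃ j ∈ v, a i j).card ≤ k * d := by
      intro v hv
      rw [mem_tuples] at hv
      have : ((Finset.range n).filter fun i => ∃ j ∈ v, a i j) ⊆
          v.toFinset.biUnion fun j => (Finset.range n).filter fun i => a i j := by
        intro i hi
        simp only [Finset.mem_filter, Finset.mem_biUnion, List.mem_toFinset] at hi ⊢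
        obtain ⟨hi, j, hj, h⟩ := hi
        exact ⟨j, hj, hi, h⟩
      refine (Finset.card_le_card this).trans ?_
      refine (Finset.card_biUnion_le_card_mul _ _ d fun j hj => ha j ?_).trans ?_
      · exact hv.2 j (List.mem_toFinset.1 hj)
      · gcongr
        exact hv.1 ▸ List.toFinset_card_le v
    calc _ ≤ ∑ i ∈ Finset.range n, ∑ v ∈ tuples n k, (((if ∃ j ∈ v, a i j then 1 else 0) +
          if ∃ j ∈ v, a j i then 1 else 0) +
          if ¬ v.Pairwise fun i j => ¬ (a i j ∨ a j i) then 1 else 0) := by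
          refine Finset.sum_le_sum fun i _ => Finset.sum_le_sum fun v _ => ?_
          by_cases h1 : ∃ j ∈ v, a i j
          · rw [if_pos h1]; split_ifs <;> omega
          by_cases h2 : ∃ j ∈ v, a j i
          · rw [if_pos h2]; split_ifs <;> omega
          push Not at h1 h2
          have : (i :: v).Pairwise (fun i j => ¬ (a i j ∨ a j i)) ↔
              v.Pairwise fun i j => ¬ (a i j ∨ a j i) := by
            rw [List.pairwise_cons, and_iff_right]
            intro j hj
            simp [h1 j hj, h2 j hj]
          simp only [this]
          omega
      _ = (∑ v ∈ tuples n k, ((Finset.range n).filter fun i => ∃ j ∈ v, a i j).card) +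
          (∑ i ∈ Finset.range n, ((tuples n k).filter fun v => ∃ j ∈ v, a j i).card) +
          n * ((tuples n k).filter fun v => ¬ v.Pairwise fun i j => ¬ (a i j ∨ a j i)).card := by
          have h2 : ∑ v ∈ tuples n k, ((Finset.range n).filter fun i => ∃ j ∈ v, a i j).card =
              ∑ i ∈ Finset.range n, ((tuples n k).filter fun v => ∃ j ∈ v, a i j).card := by
            simp only [Finset.card_filter]
            exact Finset.sum_comm
          rw [h2]
          simp only [Finset.sum_add_distrib, Finset.sum_const, smul_eq_mul, Finset.card_range,
            ← Finset.card_filter]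
      _ ≤ (∑ v ∈ tuples n k, k * d) + (∑ i ∈ Finset.range n, k * d * n ^ (k - 1)) +
          n * (d * k ^ 2 * n ^ (k - 1)) := by
          refine add_le_add (add_le_add (Finset.sum_le_sum h1) (Finset.sum_le_sum ?_)) ?_
          · intro i hi
            exact card_tuples_filter_exists_le n d k _ (ha i (Finset.mem_range.1 hi))
          · gcongr
      _ ≤ d * (k + 1) ^ 2 * n ^ k := by
          simp only [Finset.sum_const, card_tuples, smul_eq_mul, Finset.card_range]
          cases k with
          | zero => simp
          | succ k =>
            rw [Nat.add_sub_cancel]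
            -- The three contributions sum to one term `d * n ^ (k + 1)` less than the square, as
            -- `(k + 1) ^ 2 + 2 * (k + 1) + 1 = (k + 2) ^ 2`.
            have : n ^ (k + 1) * ((k + 1) * d) + n * ((k + 1) * d * n ^ k) +
              n * (d * (k + 1) ^ 2 * n ^ k) + d * n ^ (k + 1) =
                d * (k + 1 + 1) ^ 2 * n ^ (k + 1) := by ring
            omega

end Counting

namespace FactForest

variable {A : Type u}

/-! ## The number of dependent tuples of positions -/

theorem exists_finset_ancestorOrSibling (t : List ℕ) :
    ∃ S : Finset (List ℕ), S.card ≤ 3 * (t.length + 1) ∧ ∀ s, AncestorOrSibling s t → s ∈ S := by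
  -- Every such `s` is a prefix of `t` whose last index, if any, is shifted by `p.2 - 1`, that is by
  -- `-1`, `0` or `1`. Truncation at index `0` at worst lists superfluous paths.
  let f : ℕ × ℕ → List ℕ := fun p =>
    (t.take p.1).dropLast ++ ((t.take p.1).getLast?.map fun i => i + p.2 - 1).toList
  have hf : ∀ q i e, e < 3 → q ++ [i] <+: t →
      q ++ [i + e - 1] ∈ (Finset.range (t.length + 1) ×ˢ Finset.range 3).image f := by
    intro q i e he h
    refine Finset.mem_image.2 ⟨((q ++ [i]).length, e), ?_, ?_⟩
    · simp only [Finset.mem_product, Finset.mem_range]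
      exact ⟨Nat.lt_succ_of_le h.length_le, he⟩
    · simp only [f, ← List.prefix_iff_eq_take.1 h]
      simp
  refine ⟨(Finset.range (t.length + 1) ×ˢ Finset.range 3).image f, ?_, ?_⟩
  · refine Finset.card_image_le.trans ?_
    simp [Finset.card_product, Nat.mul_comm]
  · rintro s (h | ⟨q, i, ⟨rfl, h⟩ | ⟨rfl, h⟩⟩)
    · rcases List.eq_nil_or_concat s with rfl | ⟨q, i, rfl⟩
      · exact Finset.mem_image.2 ⟨(0, 0), by simp, by simp [f]⟩
      · rw [List.concat_eq_append] at h ⊢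
        simpa using hf q i 1 (by norm_num) h
    · simpa using hf q (i + 1) 0 (by norm_num) h
    · simpa using hf q i 2 (by norm_num) h

open Classical in
theorem card_filter_ancestorOrSibling_le {F : FactForest A} {K : ℕ} (hK : F.height ≤ K)
    (t : List ℕ) (ht : t.length ≤ K) :
    ((Finset.range F.yield.length).filter fun j => AncestorOrSibling (F.owner j) t).card ≤
      3 * (K + 1) * 2 ^ K := by
  obtain ⟨S, hS, hS'⟩ := exists_finset_ancestorOrSibling t
  have : ((Finset.range F.yield.length).filter fun j => AncestorOrSibling (F.owner j) t) ⊆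
      S.biUnion F.frontier := by
    intro j hj
    rw [Finset.mem_filter, Finset.mem_range] at hj
    exact Finset.mem_biUnion.2 ⟨_, hS' _ hj.2, ((mem_frontier_iff F j _).2 ⟨hj.1, rfl⟩).1⟩
  refine (Finset.card_le_card this).trans ((Finset.card_biUnion_le_card_mul _ _ (2 ^ K) ?_).trans ?_)
  · intro s _
    exact (card_frontier_le F s).trans (Nat.pow_le_pow_right (by norm_num) hK)
  · gcongr
    exact hS.trans (by gcongr)

/-- The owners of some positions form a dependent multiset. -/
def Dependent (F : FactForest A) (v : List ℕ) : Prop :=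
  (∃ i ∈ v, F.owner i = []) ∨ ¬ v.Pairwise fun i j => ¬ F.Linked i j

-- Since only `[]` is related to `[]`, root-owned positions obey the same bound, with `t = []`, as
-- the partners of a given position.
open Classical in
theorem card_filter_dependent_le {F : FactForest A} {K : ℕ} (hK : F.height ≤ K) (k : ℕ) :
    ((tuples F.yield.length k).filter F.Dependent).card ≤
      (k * (3 * (K + 1) * 2 ^ K) + 3 * (K + 1) * 2 ^ K * k ^ 2) * F.yield.length ^ (k - 1) := by
  have h1 := card_tuples_filter_exists_le F.yield.length (3 * (K + 1) * 2 ^ K) k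
    (fun i => AncestorOrSibling (F.owner i) [])
    (card_filter_ancestorOrSibling_le hK [] (by simp))
  have h2 := card_tuples_filter_not_pairwise_le F.yield.length (3 * (K + 1) * 2 ^ K) k
    (fun i j => AncestorOrSibling (F.owner i) (F.owner j))
    (fun t ht => card_filter_ancestorOrSibling_le hK _ ((length_owner_le F t ht).trans hK))
  rw [add_mul]
  refine le_trans ?_ (add_le_add h1 h2)
  refine le_trans (Finset.card_le_card ?_) (Finset.card_union_le _ _)
  intro v hv
  simp only [Finset.mem_filter, Finset.mem_union, Dependent] at hv ⊢
  rcases hv with ⟨h, h' | h'⟩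
  · simp only [ancestorOrSibling_nil_right]
    exact Or.inl ⟨h, h'⟩
  · exact Or.inr ⟨h, h'⟩

theorem owner_mem_insert_iter {F : FactForest A} {i : ℕ} (hi : i < F.yield.length) :
    F.owner i ∈ insert [] F.iter :=
  ((mem_frontier_iff F i _).2 ⟨hi, rfl⟩).2

/-- Reflexivity of `AncestorOrSibling` makes two entries with the same owner linked, so the pairwise
condition over entries includes the absence of repetitions. -/
theorem independent_map_owner_iff {F : FactForest A} {v : List ℕ}
    (hv : ∀ i ∈ v, i < F.yield.length) :
    F.Independent ((v : Multiset ℕ).map F.owner) ↔ ¬ F.Dependent v := by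
  have h1 : (∀ t ∈ (v : Multiset ℕ).map F.owner, t ∈ F.iter) ↔ ¬ ∃ i ∈ v, F.owner i = [] := by
    simp only [Multiset.mem_map, Multiset.mem_coe, forall_exists_index, and_imp,
      forall_apply_eq_imp_iff₂, not_exists, not_and]
    refine forall₂_congr fun i hi => ?_
    have := owner_mem_insert_iter (hv i hi)
    rw [Finset.mem_insert] at this
    constructor
    · intro h h'
      rw [h'] at h
      exact nil_notMem_iter F h
    · exact fun h => this.resolve_left h
  rw [Independent, h1, Dependent, not_or, not_not]
  refine and_congr_right fun _ => ?_
  have h2 : v.Pairwise (fun i j => ¬ F.Linked i j) ↔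
      (v.map F.owner).Pairwise fun s t => ¬ AncestorOrSibling s t ∧ ¬ AncestorOrSibling t s := by
    rw [List.pairwise_map]
    simp only [Linked, not_or]
  rw [h2, Multiset.map_coe, Multiset.coe_nodup]
  simp only [Multiset.mem_coe]
  constructor
  · rintro ⟨h3, h4⟩
    exact List.Pairwise.imp_of_mem (fun hs ht hne => ⟨h4 _ hs _ ht hne, h4 _ ht _ hs hne.symm⟩) h3
  · intro h
    refine ⟨h.imp ?_, ?_⟩
    · rintro s _ ⟨h', -⟩ rfl
      exact h' (ancestorOrSibling_refl s)
    · intro s hs t ht hne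
      have : Std.Symm fun s t : List ℕ => ¬ AncestorOrSibling s t ∧ ¬ AncestorOrSibling t s :=
        ⟨fun _ _ h => And.symm h⟩
      exact (List.Pairwise.forall h hs ht hne).1

end FactForest

-- From multisets of nodes to tuples of positions

namespace MarbleBimachine

variable {A : Type u}

open FactForest

-- The index set in `prodSets` consists of the underlying multisets of members of `Finset.sym`; the
-- coercion is injective.
open Classical in
theorem prodSets_eq_sum {k : ℕ} (N : MarbleBimachine.{u, v} A k) (w : List A)
    (S : Multiset (Finset ℕ)) :
    N.prodSets w S = ∑ s ∈ ((Finset.range w.length).sym k).filter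
      (fun s : Sym ℕ k => Multiset.Rel (fun i I => i ∈ I) (s : Multiset ℕ) S), N.prod w s := by
  rw [prodSets]
  symm
  refine Finset.sum_bij (fun s _ => (s : Multiset ℕ)) ?_ ?_ ?_ ?_
  · intro s hs
    simp only [Finset.mem_filter, Finset.bind_def, Finset.pure_def, Finset.mem_sup,
      Finset.mem_singleton] at hs ⊢
    exact ⟨⟨s, hs.1, rfl⟩, hs.2⟩
  · intro s _ s' _ h
    exact Sym.coe_injective h
  · intro s hs
    simp only [Finset.mem_filter, Finset.bind_def, Finset.pure_def, Finset.mem_sup,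
      Finset.mem_singleton] at hs
    obtain ⟨⟨s, h1, rfl⟩, h2⟩ := hs
    exact ⟨s, Finset.mem_filter.2 ⟨h1, h2⟩, rfl⟩
  · intro s _
    rfl

open Classical in
theorem depSum_eq_sum_sym {k : ℕ} (N : MarbleBimachine.{u, v} A k) (F : FactForest A) :
    N.depSum F = ∑ s ∈ (Finset.range F.yield.length).sym k,
      if F.Independent ((s : Multiset ℕ).map F.owner) then 0 else N.prod F.yield s := by
  -- By the partition, matching positions with frontiers that contain them is matching positions
  -- with their owners. After exchanging the sums, each `s` meets at most one `T`.
  have key : ∀ s ∈ (Finset.range F.yield.length).sym k, ∀ T ∈ (insert [] F.iter).sym k,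
      Multiset.Rel (fun i I => i ∈ I) (s : Multiset ℕ) ((T : Multiset (List ℕ)).map F.frontier) ↔
        T = s.map F.owner := by
    intro s hs T hT
    rw [Finset.mem_sym_iff] at hs hT
    rw [Multiset.rel_map_right, ← Sym.coe_inj, Sym.coe_map, eq_comm, ← Multiset.rel_eq,
      Multiset.rel_map_left]
    constructor
    · intro h
      refine h.mono fun i _ t ht hit => ?_
      exact ((mem_frontier_iff F i t).1 ⟨hit, hT t ht⟩).2.symm
    · intro h
      refine h.mono fun i hi t _ hit => ?_
      exact ((mem_frontier_iff F i t).2 ⟨Finset.mem_range.1 (hs i hi), hit.symm⟩).1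
  rw [depSum]
  simp only [prodSets_eq_sum]
  rw [Finset.sum_comm' (s' := fun s => if F.Independent ((s : Multiset ℕ).map F.owner) then ∅ else
    {s.map F.owner}) (t' := (Finset.range F.yield.length).sym k)]
  · refine Finset.sum_congr rfl fun s _ => ?_
    split_ifs <;> simp
  · intro T s
    simp only [deps, Finset.mem_filter]
    constructor
    · rintro ⟨⟨hT, hI⟩, hs, hR⟩
      obtain rfl := (key s hs T hT).1 hR
      rw [Sym.coe_map] at hI
      exact ⟨by simp [hI], hs⟩
    · rintro ⟨hT, hs⟩
      split_ifs at hT with hI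
      · simp at hT
      obtain rfl := Finset.mem_singleton.1 hT
      have hm : s.map F.owner ∈ (insert [] F.iter).sym k := by
        rw [Finset.mem_sym_iff] at hs ⊢
        intro t ht
        obtain ⟨i, hi, rfl⟩ := Sym.mem_map.1 ht
        exact owner_mem_insert_iter (Finset.mem_range.1 (hs i hi))
      exact ⟨⟨hm, by rwa [Sym.coe_map]⟩, hs, (key s hs _ hm).2 rfl⟩

-- Sorting in decreasing order embeds multisets into tuples; all tuples outside the image have
-- production zero.
open Classical in
theorem depSum_eq_sum_tuples {k : ℕ} (N : MarbleBimachine.{u, v} A k) (F : FactForest A) :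
    N.depSum F = ∑ v ∈ tuples F.yield.length k,
      if F.Dependent v then N.prodList F.yield v else 0 := by
  rw [depSum_eq_sum_sym]
  refine Finset.sum_of_injOn (fun s => (s : Multiset ℕ).sort (· ≥ ·)) ?_ ?_ ?_ ?_
  · intro s _ s' _ h
    have := congrArg (fun l : List ℕ => (l : Multiset ℕ)) h
    simpa using this
  · intro s hs
    rw [Finset.mem_coe, Finset.mem_sym_iff] at hs
    rw [Finset.mem_coe, mem_tuples]
    refine ⟨by simp, fun i hi => ?_⟩
    simpa using hs i (by simpa using hi)
  · intro v hv hv'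
    by_contra h
    rw [ite_eq_right_iff, Classical.not_imp] at h
    obtain ⟨h1, h2⟩ := prodList_ne_zero N _ _ h.2
    rw [mem_tuples] at hv
    apply hv'
    obtain ⟨s, hs⟩ : ∃ s : Sym ℕ k, (s : Multiset ℕ) = v :=
      ⟨⟨(v : Multiset ℕ), by simpa using hv.1⟩, rfl⟩
    refine ⟨s, ?_, ?_⟩
    · rw [Finset.mem_coe, Finset.mem_sym_iff]
      intro i hi
      rw [← Sym.mem_coe, hs] at hi
      exact Finset.mem_range.2 (hv.2 i hi)
    · have : ((v : Multiset ℕ).sort (· ≥ ·)) = v := by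
        rw [Multiset.coe_sort]
        exact List.mergeSort_eq_self _ h1
      simpa [hs] using this
  · intro s hs
    have h := independent_map_owner_iff (F := F) (v := (s : Multiset ℕ).sort (· ≥ ·)) (by
      intro i hi
      rw [Finset.mem_sym_iff] at hs
      simpa using hs i (by simpa using hi))
    rw [Multiset.sort_eq] at h
    simp only [h]
    by_cases h' : F.Dependent ((s : Multiset ℕ).sort (· ≥ ·)) <;> simp [h', prod]

theorem exists_depSum_le [Finite A] {k : ℕ} (N : MarbleBimachine.{u, v} A k) (K : ℕ) :
    ∃ C, ∀ F : FactForest A, F.height ≤ K → N.depSum F ≤ C * F.yield.length ^ (k - 1) := by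
  classical
  obtain ⟨C, hC⟩ := N.exists_prodList_le
  refine ⟨C * (k * (3 * (K + 1) * 2 ^ K) + 3 * (K + 1) * 2 ^ K * k ^ 2), fun F hF => ?_⟩
  rw [depSum_eq_sum_tuples, ← Finset.sum_filter]
  calc _ ≤ ((tuples F.yield.length k).filter F.Dependent).card • C :=
        Finset.sum_le_card_nsmul _ _ _ fun v _ => hC _ _
    _ ≤ _ := by
      rw [smul_eq_mul, Nat.mul_comm, Nat.mul_assoc]
      exact Nat.mul_le_mul_left _ (card_filter_dependent_le hF k)

end MarbleBimachine

/-! ## Positions of letters among brackets -/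

section LetterPos

variable {B C : Type*} (f : B → Option C)

/-- The position in `x` of the letter that becomes number `i` in `x.filterMap f`. -/
def letterPos : List B → ℕ → ℕ
  | [], i => i
  | b :: x, i =>
    match f b, i with
    | none, i => letterPos x i + 1
    | some _, 0 => 0
    | some _, i + 1 => letterPos x i + 1

/-- The value on `[]` continues the numbering beyond the end of the word, so no bound on the
arguments is needed. -/
theorem letterPos_injective (x : List B) : Function.Injective (letterPos f x) := by
  induction x with
  | nil => exact fun i j h => h
  | cons b x ih =>
    intro i j h
    simp only [letterPos] at h
    cases hb : f b with
    | none =>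
      simp only [hb, Nat.add_right_cancel_iff] at h
      exact ih h
    | some c =>
      cases i <;> cases j <;> simp only [hb, Nat.add_right_cancel_iff] at h
      · rfl
      · omega
      · omega
      · rw [ih h]

theorem getElem?_letterPos (x : List B) (i : ℕ) (hi : i < (x.filterMap f).length) :
    ∃ b, x[letterPos f x i]? = some b ∧ f b ≠ none := by
  induction x generalizing i with
  | nil => simp at hi
  | cons b x ih =>
    simp only [letterPos]
    cases hb : f b with
    | none =>
      rw [List.filterMap_cons_none hb] at hi
      simpa using ih i hi
    | some c =>
      rw [List.filterMap_cons_some hb] at hi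
      cases i with
      | zero => exact ⟨b, by simp, by simp [hb]⟩
      | succ i => simpa using ih i (by simpa using hi)

theorem exists_letterPos_eq (x : List B) (p : ℕ) (b : B) (hp : x[p]? = some b) (hb : f b ≠ none) :
    ∃ i < (x.filterMap f).length, letterPos f x i = p := by
  induction x generalizing p with
  | nil => simp at hp
  | cons c x ih =>
    cases hc : f c with
    | none =>
      cases p with
      | zero =>
        simp only [List.getElem?_cons_zero, Option.some.injEq] at hp
        exact absurd (hp ▸ hc) hb
      | succ p =>
        obtain ⟨i, hi, rfl⟩ := ih p (by simpa using hp)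
        exact ⟨i, by rwa [List.filterMap_cons_none hc], by simp [letterPos, hc]⟩
    | some d =>
      cases p with
      | zero => exact ⟨0, by simp [List.filterMap_cons_some hc], by simp [letterPos, hc]⟩
      | succ p =>
        obtain ⟨i, hi, rfl⟩ := ih p (by simpa using hp)
        exact ⟨i + 1, by simpa [List.filterMap_cons_some hc] using hi, by simp [letterPos, hc]⟩

/-- The letter map `f` on tagged letters. -/
def tagMap (b : B × List Bool) : Option (C × List Bool) := (f b.1).map fun c => (c, b.2)

/-- The hypothesis concerns positions of letters only, because tags on brackets are discarded. Both
offsets vary for the induction. -/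
theorem filterMap_tagFrom_map (x : List B) (u : List ℕ) (g : ℕ → ℕ) (o o' : ℕ)
    (h : ∀ j ∈ u, ∀ i < (x.filterMap f).length, g j = o + letterPos f x i ↔ j = o' + i) :
    (tagFrom (u.map g) o x).filterMap (tagMap f) = tagFrom u o' (x.filterMap f) := by
  induction x generalizing o o' with
  | nil => rfl
  | cons b x ih =>
    rw [tagFrom]
    cases hb : f b with
    | none =>
      rw [List.filterMap_cons_none hb, List.filterMap_cons_none (by simp [tagMap, hb])]
      refine ih _ _ fun j hj i hi => ?_
      rw [← h j hj i (by rwa [List.filterMap_cons_none hb])]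
      simp only [letterPos, hb]
      omega
    | some c =>
      rw [List.filterMap_cons_some hb,
        List.filterMap_cons_some (b := (c, (u.map g).map (· == o))) (by simp [tagMap, hb]), tagFrom]
      congr 1
      · congr 1
        rw [List.map_map]
        refine List.map_congr_left fun j hj => ?_
        have := h j hj 0 (by simp [List.filterMap_cons_some hb])
        simp only [letterPos, hb, Nat.add_zero] at this
        simp [this]
      · refine ih _ _ fun j hj i hi => ?_
        have := h j hj (i + 1) (by simpa [List.filterMap_cons_some hb] using hi)
        simp only [letterPos, hb] at this
        omega

theorem filterMap_tagFrom_map_letterPos (x : List B) (u : List ℕ) :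
    (tagFrom (u.map (letterPos f x)) 0 x).filterMap (tagMap f) = tagFrom u 0 (x.filterMap f) := by
  refine filterMap_tagFrom_map f x u _ 0 0 fun j _ i _ => ?_
  simp only [Nat.zero_add]
  exact (letterPos_injective f x).eq_iff

end LetterPos

/-! ## Relabelling -/

namespace Bracketed

variable {A B : Type*}

/-- The letter of a symbol that is not a bracket. -/
def letter? : Bracketed A → Option A
  | letter a => some a
  | _ => none

/-- Relabelling of letters. -/
def map (f : A → B) : Bracketed A → Bracketed B
  | letter a => letter (f a)
  | op => op
  | cl => cl

/-- A tagged symbol as a symbol with a tagged letter; the tags of brackets are forgotten. -/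
def ofTagged : Bracketed A × List Bool → Bracketed (A × List Bool)
  | (letter a, t) => letter (a, t)
  | (op, _) => op
  | (cl, _) => cl

theorem map_fst_ofTagged (b : Bracketed A × List Bool) : (ofTagged b).map Prod.fst = b.1 := by
  rcases b with ⟨_ | _ | _, t⟩ <;> rfl

theorem letter?_ofTagged (b : Bracketed A × List Bool) : (ofTagged b).letter? = tagMap letter? b := by
  rcases b with ⟨_ | _ | _, t⟩ <;> rfl

end Bracketed

namespace FactForest

variable {A B : Type*}

mutual
/-- Relabelling of leaves. -/
def relabel (f : A → B) : FactForest A → FactForest B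
  | leaf a => leaf (f a)
  | node cs => node (relabelList f cs)
/-- Relabelling of the leaves of the members of a list. -/
def relabelList (f : A → B) : List (FactForest A) → List (FactForest B)
  | [] => []
  | c :: cs => relabel f c :: relabelList f cs
end

theorem relabelList_eq (f : A → B) (cs : List (FactForest A)) :
    relabelList f cs = cs.map (relabel f) := by
  induction cs with
  | nil => simp [relabelList]
  | cons c cs ih => simp [relabelList, ih]

theorem length_yield_relabel (f : A → B) (F : FactForest A) :
    (F.relabel f).yield.length = F.yield.length := by
  refine induction_on_children F ?_ ?_
  · simp [relabel, yield]
  · intro cs ih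
    rw [relabel, yield, yield, relabelList_eq]
    induction cs with
    | nil => simp [yieldList]
    | cons c cs ih' =>
      simp only [List.map_cons, yieldList, List.length_append, ih c (by simp),
        ih' fun c hc => ih c (by simp [hc])]

theorem owner_relabel (f : A → B) (F : FactForest A) : ∀ i, (F.relabel f).owner i = F.owner i := by
  refine induction_on_children F ?_ ?_
  · simp [relabel, owner]
  · intro cs ih i
    rw [relabel, owner, owner, relabelList_eq, List.length_map]
    -- The number of siblings and the running index must be free in the induction on the list.
    generalize cs.length = n
    generalize 0 = j
    induction cs generalizing i j with
    | nil => simp [ownerFrom]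
    | cons c cs ih' =>
      simp only [List.map_cons, ownerFrom, length_yield_relabel, ih c (by simp),
        ih' (fun c hc => ih c (by simp [hc]))]

/-- The parser never looks at labels. -/
theorem parse_map (f : A → B) (K : ℕ) (x : List (Bracketed A)) :
    parse K (x.map (Bracketed.map f)) = (parse K x).map (List.map (relabel f)) := by
  induction x using List.reverseRecOn with
  | nil => simp [parse, relabel, relabelList]
  | append_singleton x b ih =>
    rw [List.map_append, List.map_singleton, parse_append_singleton, ih, parse_append_singleton]
    generalize parse K x = s
    rcases s with _ | s
    · simp [parseStep]
    rcases s with _ | ⟨c, s⟩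
    · simp [parseStep]
    rcases b with a | _ | _
    · rcases c with a' | cs
      · simp [parseStep, relabel, Bracketed.map]
      · cases cs <;> simp [parseStep, relabel, relabelList, Bracketed.map]
    · rcases c with a' | cs
      · simp [parseStep, relabel, Bracketed.map]
      · by_cases h : s.length < K <;> simp [parseStep, relabel, relabelList, Bracketed.map, h]
    · rcases s with _ | ⟨d, s⟩
      · cases c <;> simp [parseStep, relabel, Bracketed.map]
      · rcases d with a' | ds
        · cases c <;> simp [parseStep, relabel, Bracketed.map]
        · cases c <;> simp [parseStep, relabel, relabelList_eq, Bracketed.map]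

/-- The tree `F'` is obtained by running the parser on `x`, which succeeds because it does on the
relabelled word. -/
theorem exists_relabel_eq (f : A → B) {K : ℕ} {F : FactForest B} (hF : F.height ≤ K)
    {x : List (Bracketed A)} (hx : x.map (Bracketed.map f) = encode F) :
    ∃ F' : FactForest A, encode F' = x ∧ F'.height ≤ K ∧ F'.relabel f = F := by
  have h := parse_eq_some_singleton.2 ⟨hx.symm, hF⟩
  rw [parse_map, Option.map_eq_some_iff] at h
  obtain ⟨s, hs, h⟩ := h
  obtain ⟨F', rfl, h'⟩ := List.map_eq_singleton_iff.1 h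
  obtain ⟨h1, h2⟩ := parse_eq_some_singleton.1 hs
  exact ⟨F', h1, h2, h'⟩

theorem filterMap_letter?_encode (F : FactForest A) :
    (encode F).filterMap Bracketed.letter? = F.yield := by
  refine induction_on_children F ?_ ?_
  · intro a
    simp [encode, yield, Bracketed.letter?]
  · intro cs ih
    rw [encode, yield]
    induction cs with
    | nil => simp [encodeList, yieldList]
    | cons c cs ih' =>
      rw [encodeList, List.filterMap_cons_none rfl, List.filterMap_append,
        List.filterMap_cons_none rfl, ih c (by simp), ih' fun c hc => ih c (by simp [hc]), yieldList]

end FactForest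

namespace FactForest

variable {A : Type u}

/-! ## Dependence of the tagged positions is regular -/

/-- A tagged letter is marked by the member number `j` of the tuple of positions. -/
def Marks (j : ℕ) (b : A × List Bool) : Prop := b.2[j]? = some true

/-- Dependence of the positions marked in a tagged encoding. -/
def MarkedDependent (K k : ℕ) (y : List (Bracketed A × List Bool)) : Prop :=
  (∃ j : Fin k, ∃ F : FactForest (A × List Bool), encode F = y.map Bracketed.ofTagged ∧
    F.height ≤ K ∧ F.OccursAtRoot (Marks j)) ∨
  ∃ j l : Fin k, j < l ∧ ∃ F : FactForest (A × List Bool), encode F = y.map Bracketed.ofTagged ∧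
    F.height ≤ K ∧ F.OccursLinked (Marks j) (Marks l)

/-- A finite Boolean combination, over members and pairs of members of the tuple, of conditions read
off from `occurrences`. -/
theorem isRegularFun_markedDependent (K k : ℕ) :
    IsRegularFun fun y : List (Bracketed A × List Bool) => MarkedDependent K k y := by
  have h : ∀ (p : Occurrences → Prop) (P Q : A × List Bool → Prop),
      IsRegularFun fun y : List (Bracketed A × List Bool) =>
        ∃ F : FactForest (A × List Bool), encode F = y.map Bracketed.ofTagged ∧ F.height ≤ K ∧
          p (occurrences P Q F) := by
    intro p P Q
    obtain ⟨G, hG, hG'⟩ := isRegularFun_occurrences P Q K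
    have h := (hG.comap (List.map Bracketed.ofTagged) fun u v => by simp).comp
      fun o => ∃ s, o = some s ∧ p s
    convert h using 3 with y
    constructor
    · rintro ⟨F, h1, h2, h3⟩
      exact ⟨_, (hG' _ _).2 ⟨F, h1, h2, rfl⟩, h3⟩
    · rintro ⟨s, hs, h3⟩
      obtain ⟨F, h1, h2, rfl⟩ := (hG' _ _).1 hs
      exact ⟨F, h1, h2, h3⟩
  have h1 := (IsRegularFun.pi fun j : Fin k =>
    h (fun s => s.rootLeft) (Marks j) (Marks j)).comp fun q => ∃ j, q j
  have h2 := (IsRegularFun.pi fun j : Fin k => IsRegularFun.pi fun l : Fin k =>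
    h (fun s => s.linked) (Marks j) (Marks l)).comp fun q => ∃ j l, j < l ∧ q j l
  exact (h1.prodMk h2).comp fun q => q.1 ∨ q.2

theorem hasLabel_marks_iff {F : FactForest (A × List Bool)} {u : List ℕ} {w : List A}
    (hF : F.yield = tagFrom u 0 w) {j i : ℕ} :
    F.HasLabel (Marks j) i ↔ i < w.length ∧ u[j]? = some i := by
  have h : ∀ i, (u[j]?.map (· == i)) = some true ↔ u[j]? = some i := by
    intro i
    cases u[j]? <;> simp
  simp only [HasLabel, hF, Marks]
  constructor
  · rintro ⟨b, hb, hm⟩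
    obtain ⟨hi, rfl⟩ := List.getElem?_eq_some_iff.1 hb
    simp only [getElem_tagFrom, Nat.zero_add, List.getElem?_map, h] at hm
    exact ⟨by simpa using hi, hm⟩
  · rintro ⟨hi, hj⟩
    refine ⟨_, List.getElem?_eq_getElem (by simpa using hi), ?_⟩
    simp only [getElem_tagFrom, Nat.zero_add, List.getElem?_map, h]
    exact hj

/-- The tagged word encodes a single tree, so all existential quantifiers in `MarkedDependent` refer
to it. It is a relabelling of `F`, hence has the same owners. -/
theorem markedDependent_iff {K k : ℕ} {F : FactForest A} (hF : F.height ≤ K)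
    {y : List (Bracketed A × List Bool)} (hy : y.map Prod.fst = encode F) {u : List ℕ}
    (hu : u ∈ tuples F.yield.length k)
    (hyu : y.filterMap (tagMap Bracketed.letter?) = tagFrom u 0 F.yield) :
    MarkedDependent K k y ↔ F.Dependent u := by
  obtain ⟨F', h1, h2, h3⟩ := exists_relabel_eq (f := Prod.fst) (x := y.map Bracketed.ofTagged) hF
    (by rw [← hy, List.map_map]; exact List.map_congr_left fun b _ => Bracketed.map_fst_ofTagged b)
  have hyield : F'.yield = tagFrom u 0 F.yield := by
    rw [← filterMap_letter?_encode, h1, List.filterMap_map, ← hyu]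
    exact List.filterMap_congr fun b _ => Bracketed.letter?_ofTagged b
  have howner : ∀ i, F'.owner i = F.owner i := fun i => by rw [← h3, owner_relabel]
  have huniq : ∀ p : FactForest (A × List Bool) → Prop,
      (∃ G, encode G = y.map Bracketed.ofTagged ∧ G.height ≤ K ∧ p G) ↔ p F' := by
    intro p
    constructor
    · rintro ⟨G, hG, -, hp⟩
      obtain rfl := encode_injective (hG.trans h1.symm)
      exact hp
    · exact fun hp => ⟨F', h1, h2, hp⟩
  rw [mem_tuples] at hu
  obtain ⟨rfl, hu⟩ := hu
  simp only [MarkedDependent, huniq, OccursAtRoot, OccursLinked, hasLabel_marks_iff hyield, Linked,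
    howner]
  refine or_congr ?_ ?_
  · constructor
    · rintro ⟨j, i, ⟨-, hj⟩, h⟩
      exact ⟨i, List.mem_of_getElem? hj, h⟩
    · rintro ⟨i, hi, h⟩
      obtain ⟨j, hj, rfl⟩ := List.getElem_of_mem hi
      exact ⟨⟨j, hj⟩, _, ⟨hu _ hi, List.getElem?_eq_getElem hj⟩, h⟩
  · rw [List.pairwise_iff_getElem]
    push Not
    constructor
    · rintro ⟨j, l, hjl, i, i', ⟨-, hi⟩, ⟨-, hi'⟩, h⟩
      obtain ⟨hj, rfl⟩ := List.getElem?_eq_some_iff.1 hi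
      obtain ⟨hl, rfl⟩ := List.getElem?_eq_some_iff.1 hi'
      exact ⟨j, l, hj, hl, hjl, h⟩
    · rintro ⟨j, l, hj, hl, hjl, h⟩
      exact ⟨⟨j, hj⟩, ⟨l, hl⟩, hjl, _, _, ⟨hu _ (List.getElem_mem hj), List.getElem?_eq_getElem hj⟩,
        ⟨hu _ (List.getElem_mem hl), List.getElem?_eq_getElem hl⟩, h⟩

end FactForest

-- Assembly: the regular summand, computability and growth

namespace MarbleBimachine

variable {A : Type u}

open FactForest

/-- The sum of the productions over the dependent multisets is a sum, over the tuples of positions of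
the encoding, of a regular function of the tagged encoding. -/
theorem exists_isRegularFun_sum_eq_depSum [Finite A] {M : Type v} [Monoid M] [Finite M]
    (μ : FreeMonoid A →* M) {k : ℕ} (N : MarbleBimachine.{u, v} A k) (K : ℕ) :
    ∃ G : List (Bracketed A × List Bool) → ℕ, IsRegularFun G ∧
      (∀ F : FactForest A, IsProper μ F → F.height ≤ K →
        ∑ v ∈ tuples (encode F).length k, G (tagFrom v 0 (encode F)) = N.depSum F) ∧
      ∀ y, (¬ ∃ F : FactForest A, encode F = y.map Prod.fst ∧ F.height ≤ K ∧ IsProper μ F) →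
        G y = 0 := by
  classical
  obtain ⟨P, hP, hP'⟩ := N.exists_isRegularFun_prodList
  -- Pebbles also visit brackets; tuples with an entry on a bracket must contribute zero.
  let bad : Bracketed A × List Bool → Prop := fun b => b.1.letter? = none ∧ true ∈ b.2
  have hreg := ((((isRegularFun_isProper μ K).comap (List.map Prod.fst)
    fun (u v : List (Bracketed A × List Bool)) => by simp).prodMk
    (IsRegularFun.forall_mem fun b => ¬ bad b)).prodMk
    ((isRegularFun_markedDependent (A := A) K k).prodMk
    (hP.comap (List.filterMap (tagMap Bracketed.letter?)) fun u v => by simp))).comp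
    fun q : (Prop × Prop) × (Prop × ℕ) => if (q.1.1 ∧ q.1.2) ∧ q.2.1 then q.2.2 else 0
  refine ⟨_, hreg, ?_, ?_⟩
  · intro F hF hK
    rw [depSum_eq_sum_tuples]
    symm
    have hx := filterMap_letter?_encode F
    -- Tuples of positions of the word embed into tuples of positions of its encoding; those outside
    -- the image have an entry on a bracket.
    refine Finset.sum_of_injOn (List.map (letterPos Bracketed.letter? (encode F))) ?_ ?_ ?_ ?_
    · exact (List.map_injective_iff.2 (letterPos_injective _ _)).injOn
    · intro u hu
      rw [Finset.mem_coe, mem_tuples] at hu ⊢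
      refine ⟨by simpa using hu.1, ?_⟩
      intro p hp
      obtain ⟨i, hi, rfl⟩ := List.mem_map.1 hp
      obtain ⟨b, hb, -⟩ := getElem?_letterPos Bracketed.letter? (encode F) i (hx ▸ hu.2 i hi)
      exact (List.getElem?_eq_some_iff.1 hb).1
    · intro v hv hv'
      rw [mem_tuples] at hv
      refine if_neg fun h => hv' ?_
      have hno := h.1.2
      have hex : ∀ p ∈ v, ∃ i < F.yield.length, letterPos Bracketed.letter? (encode F) i = p := by
        intro p hp
        have hp' := hv.2 p hp
        rw [← hx]
        refine exists_letterPos_eq Bracketed.letter? _ p _ (List.getElem?_eq_getElem hp') fun hb => ?_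
        refine hno _ (List.getElem_mem (n := p) (by simpa using hp')) ?_
        simp only [bad, getElem_tagFrom, Nat.zero_add]
        exact ⟨hb, List.mem_map.2 ⟨p, hp, by simp⟩⟩
      choose! g hg using hex
      refine ⟨v.map g, ?_, ?_⟩
      · rw [Finset.mem_coe, mem_tuples]
        refine ⟨by simpa using hv.1, fun i hi => ?_⟩
        obtain ⟨p, hp, rfl⟩ := List.mem_map.1 hi
        exact (hg p hp).1
      · rw [List.map_map]
        conv_rhs => rw [← List.map_id v]
        exact List.map_congr_left fun p hp => (hg p hp).2
    · intro u hu
      have hy := filterMap_tagFrom_map_letterPos Bracketed.letter? (encode F) u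
      rw [hx] at hy
      have h1 : ∃ G : FactForest A, encode G = encode F ∧ G.height ≤ K ∧ IsProper μ G :=
        ⟨F, rfl, hK, hF⟩
      have h2 : ∀ b ∈ tagFrom (u.map (letterPos Bracketed.letter? (encode F))) 0 (encode F),
          ¬ bad b := by
        intro b hb
        obtain ⟨p, hp, rfl⟩ := List.getElem_of_mem hb
        simp only [bad, getElem_tagFrom, Nat.zero_add]
        rintro ⟨h, h'⟩
        obtain ⟨q, hq, h'⟩ := List.mem_map.1 h'
        obtain ⟨i, hi, rfl⟩ := List.mem_map.1 hq
        rw [beq_iff_eq] at h'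
        subst h'
        obtain ⟨b, hb, hb'⟩ := getElem?_letterPos Bracketed.letter? (encode F) i
          (hx ▸ (mem_tuples.1 hu).2 i hi)
        obtain ⟨hb, rfl⟩ := List.getElem?_eq_some_iff.1 hb
        exact hb' h
      have h3 := markedDependent_iff hK (map_fst_tagFrom _ 0 (encode F)) hu hy
      simp only [map_fst_tagFrom, hy, h3, hP' _ _ (mem_tuples.1 hu).1, h1, true_and]
      by_cases h4 : F.Dependent u
      · rw [if_pos h4, if_pos ⟨h2, h4⟩]
      · rw [if_neg h4, if_neg fun h => h4 h.2]
  · intro y hy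
    exact if_neg fun h => hy h.1.1

/-- The empty word has no tuple of positive length. -/
theorem depSum_node_nil {k : ℕ} (N : MarbleBimachine.{u, v} A (k + 1)) :
    N.depSum (FactForest.node []) = 0 := by
  rw [depSum_eq_sum_tuples]
  simp [yield, yieldList, tuples]

theorem pebbleComputable_sumd [Finite A] {k : ℕ} (N : MarbleBimachine.{u, v} A (k + 1)) (K : ℕ) :
    PebbleComputable (k + 1) (N.sumd K) := by
  cases N with
  | node M μ out =>
    set N : MarbleBimachine.{u, v} A (k + 1) := node M μ out with hN
    obtain ⟨G, hG, hG1, hG2⟩ := exists_isRegularFun_sum_eq_depSum μ N K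
    convert pebbleComputable_sum_tuples k G hG using 1
    funext x
    by_cases h : ∃ F : FactForest A, IsProper μ F ∧ F.height ≤ K ∧ F.encode = x
    · obtain ⟨F, h1, h2, rfl⟩ := h
      rw [hG1 F h1 h2]
      exact sumd_encode N K F (Or.inr h1) h2
    · rw [Finset.sum_eq_zero]
      -- The only factorization that is not proper is the empty forest, where both sides vanish.
      · by_cases h' : ∃ F : FactForest A, N.IsFactorization F ∧ F.height ≤ K ∧ F.encode = x
        · obtain ⟨F, h1, h2, rfl⟩ := h'
          rcases h1 with rfl | h1
          · rw [sumd_encode N K _ (Or.inl rfl) h2, depSum_node_nil]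
          · exact absurd ⟨F, h1, h2, rfl⟩ h
        · exact dif_neg h'
      · rintro v -
        refine hG2 _ ?_
        rintro ⟨F, h1, h2, h3⟩
        rw [map_fst_tagFrom] at h1
        exact h ⟨F, h3, h2, h1⟩

theorem exists_sumd_le [Finite A] {k : ℕ} (N : MarbleBimachine.{u, v} A k) (K : ℕ) :
    ∃ C : ℕ, ∀ x : List (Bracketed A), N.sumd K x ≤ C * x.length ^ (k - 1) := by
  obtain ⟨C, hC⟩ := N.exists_depSum_le K
  refine ⟨C, fun x => ?_⟩
  by_cases h : ∃ F : FactForest A, N.IsFactorization F ∧ F.height ≤ K ∧ F.encode = x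
  · obtain ⟨F, h1, h2, rfl⟩ := h
    rw [sumd_encode N K F h1 h2]
    refine (hC F h2).trans ?_
    gcongr
    -- The factored word is the encoding without its brackets, hence not longer.
    rw [← filterMap_letter?_encode]
    exact List.length_filterMap_le _ _
  · rw [sumd, dif_neg h]
    exact Nat.zero_le _

end MarbleBimachine

theorem mainTheorem4 {A : Type u} [Finite A] {k : ℕ} (hk : 1 ≤ k)
    (N : MarbleBimachine.{u, v} A k) (K : ℕ) :
    Polyregular (N.sumd K) ∧ PebbleComputable k (N.sumd K) ∧
      ∃ C : ℕ, ∀ x : List (Bracketed A), N.sumd K x ≤ C * x.length ^ (k - 1) := by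
  obtain ⟨k, rfl⟩ := Nat.exists_eq_add_of_le' hk
  have h := N.pebbleComputable_sumd K
  exact ⟨⟨k + 1, hk, h⟩, h, N.exists_sumd_le K⟩
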